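/- **Setting.** Let $q$ be a prime power, let $\Sigma$ be a canonical $\mathbb F_q$-subgeometry of $\mathrm{PG}(4,q^5)$ (a set projectively equivalent to the set of points with coordinates in $\mathbb F_q$), let $\Gamma$ be a plane of $\mathrm{PG}(4,q^5)$ with $\Gamma\cap\Sigma=\emptyset$, and let $\Lambda\cong\mathrm{PG}(1,q^5)$ be a line disjoint from $\Gamma$. Let $\mathbb L=\wp_\Gamma(\Sigma)=\{\langle\Gamma,P\rangle\cap\Lambda : P\in\Sigma\}$ be the projection of $\Sigma$ from $\Gamma$ onto $\Lambda$. For an $\mathbb F_q$-subspace $U$ of an $\mathbb F_{q^5}$-vector space $V$, the linear set $L_U=\{\langle v\rangle_{\mathbb F_{q^5}} : v\in U,\ v\neq0\}$ is *scattered* if $\dim_{\mathbb F_q}(\langle v\rangle_{\mathbb F_{q^5}}\cap U)\le 1$ for all $v\in V$, and *maximum scattered* if moreover $U$ has the largest possible dimension over $\mathbb F_q$ among the scattered subspaces of $V$. For $f:\mathbb F_{q^5}\to\mathbb F_{q^5}$ put $L_f=\{\langle(x,f(x))\rangle_{\mathbb F_{q^5}} : x\in\mathbb F_{q^5}^*\}\subseteq\mathrm{PG}(1,q^5)$.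 A set of points of a projective line over $\mathbb F_{q^5}$ is *of pseudoregulus type* if it is projectively equivalent to $L_f$ with $f(x)=x^{q^s}$ for some $1\le s\le4$, and *of LP type* if it is projectively equivalent to $L_f$ with $f(x)=x^{q^s}+\delta x^{q^{5-s}}$ for some $1\le s\le4$ and $\delta\in\mathbb F_{q^5}$ with $\mathrm N_{q^5/q}(\delta)\notin\{0,1\}$. **Theorem.** Assume that $\mathbb L$ is a maximum scattered linear set which is not of pseudoregulus type. Let $\sigma\neq1$ be a collineation in $\mathrm{P\Gamma L}(5,q^5)$ fixing $\Sigma$ pointwise, and write $X_i=X^{\sigma^i}$. Put $$A=\Gamma\cap\Gamma^{\sigma^4},\qquad B=\Gamma\cap\Gamma^{\sigma^3},\qquad E=\langle A,B\rangle\cap\langle A_1,B_2\rangle,\qquad F=\langle A,B_2\rangle\cap\langle A_1,B\rangle.$$ Then $A$, $B$, $E$ and $F$ are points, and $\mathbb L$ is of LP type if and only if $E\in\langle A_2,A_4\rangle$ or $F\in\langle B_3,B_4\rangle$. -/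

import Mathlib

open Module

/-- The group `PΓL(V)` of collineations of the projective space `PG(V)`, acting on the lattice of
subspaces: the maps induced by the bijective semilinear maps of `V`. -/
def PGammaL (K V : Type*) [Field K] [AddCommGroup V] [Module K V] :
    Subgroup (Submodule K V ≃o Submodule K V) where
  carrier := {s | ∃ (t : K ≃+* K) (g : V ≃+ V), (∀ (c : K) (v : V), g (c • v) = t c • g v) ∧
    ∀ S : Submodule K V, (s S : Set V) = g '' (S : Set V)}
  one_mem' := ⟨RingEquiv.refl K, AddEquiv.refl V, fun _ _ => rfl, fun S => by simp⟩
  mul_mem' := by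
    rintro a b ⟨t, g, hg, ha⟩ ⟨t', g', hg', hb⟩
    refine ⟨t'.trans t, g'.trans g, fun c v => by simp [hg, hg'], fun S => ?_⟩
    rw [RelIso.mul_apply, ha, hb, ← Set.image_comp]
    rfl
  inv_mem' := by
    rintro a ⟨t, g, hg, ha⟩
    refine ⟨t.symm, g.symm, fun c v => ?_, fun S => ?_⟩
    · apply g.injective
      simp [hg]
    · have h := ha (a⁻¹ S)
      rw [RelIso.apply_inv_self] at h
      rw [h, ← Set.image_comp]
      simp

/-- The subgroup of `PΓL(V)` fixing every element of a set `Sig` of points of `PG(V)`. -/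
def pointwiseStabilizer {K V : Type*} [Field K] [AddCommGroup V] [Module K V]
    (Sig : Set (Submodule K V)) : Subgroup (Submodule K V ≃o Submodule K V) where
  carrier := {s | s ∈ PGammaL K V ∧ ∀ P ∈ Sig, s P = P}
  one_mem' := ⟨one_mem _, fun _ _ => rfl⟩
  mul_mem' := by
    rintro a b ⟨ha, ha'⟩ ⟨hb, hb'⟩
    exact ⟨mul_mem ha hb, fun P hP => by rw [RelIso.mul_apply, hb' P hP, ha' P hP]⟩
  inv_mem' := by
    rintro a ⟨ha, ha'⟩
    refine ⟨inv_mem ha, fun P hP => ?_⟩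
    conv_lhs => rw [← ha' P hP]
    exact RelIso.inv_apply_self a P

section LinearSets

variable (F K : Type*) [Field F] [Field K] [Algebra F K]

/-- The linear set `L_U` of points `⟨v⟩_K`, `v ∈ U`, `v ≠ 0`, of an `F`-subspace `U`. Points of
`PG(V)` are the one-dimensional `K`-subspaces of `V`. -/
def linearSet {F : Type*} (K : Type*) {V : Type*} [Field F] [Field K] [AddCommGroup V]
    [Module K V] [Module F V] (U : Submodule F V) : Set (Submodule K V) :=
  {P | ∃ v ∈ U, v ≠ 0 ∧ P = Submodule.span K {v}}

/-- The `F`-subspace `U` of `V` is scattered: `dim_F (⟨v⟩_K ∩ U) ≤ 1` for all `v`. -/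
def IsScattered {V : Type*} [AddCommGroup V] [Module K V] [Module F V] [IsScalarTower F K V]
    (U : Submodule F V) : Prop :=
  ∀ v : V, finrank F ↥((Submodule.span K {v}).restrictScalars F ⊓ U) ≤ 1

/-- `U` is a scattered `F`-subspace of `V` of the highest possible rank. -/
def IsMaximumScattered {V : Type*} [AddCommGroup V] [Module K V] [Module F V]
    [IsScalarTower F K V] (U : Submodule F V) : Prop :=
  IsScattered F K U ∧
    ∀ U' : Submodule F V, IsScattered F K U' → finrank F U' ≤ finrank F U

/-- `L` is a maximum scattered `F`-linear set of `PG(V)`. -/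
def IsMaximumScatteredLinearSet {V : Type*} [AddCommGroup V] [Module K V] [Module F V]
    [IsScalarTower F K V] (L : Set (Submodule K V)) : Prop :=
  ∃ U : Submodule F V, IsMaximumScattered F K U ∧ L = linearSet K U

/-- `Sig` is a canonical `F`-subgeometry of `PG(d, K)`: a set projectively equivalent to the set
of points having coordinates in `F`. -/
def IsCanonicalSubgeometry {d : ℕ} (Sig : Set (Submodule K (Fin (d + 1) → K))) : Prop :=
  ∃ g : (Fin (d + 1) → K) ≃ₗ[K] (Fin (d + 1) → K),
    Sig = {P | ∃ a : Fin (d + 1) → F, a ≠ 0 ∧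
      P = Submodule.span K {g (fun i => algebraMap F K (a i))}}

/-- The set `L_f` of points `⟨(x, f x)⟩`, `x ≠ 0`, of `PG(1, K)`. -/
def graphSet {K : Type*} [Field K] (f : K → K) : Set (Submodule K (K × K)) :=
  {P | ∃ x : K, x ≠ 0 ∧ P = Submodule.span K {(x, f x)}}

/-- The set `L` of points of the projective line `PG(V)` is projectively equivalent to the set
`L'` of points of `PG(1, K)`. -/
def IsProjectivelyEquivalent {K V : Type*} [Field K] [AddCommGroup V] [Module K V]
    (L : Set (Submodule K V)) (L' : Set (Submodule K (K × K))) : Prop :=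
  ∃ e : (K × K) ≃ₗ[K] V, L = (fun P => P.map e.toLinearMap) '' L'

/-- `L` is of pseudoregulus type: with `q = |F|` and `n = [K : F]`, it is projectively equivalent
to `L_f` for some `f(x) = x^(q^s)` with `gcd(s, n) = 1`. -/
def IsPseudoregulusType {V : Type*} [AddCommGroup V] [Module K V]
    (L : Set (Submodule K V)) : Prop :=
  ∃ s : ℕ, s < finrank F K ∧ s.Coprime (finrank F K) ∧
    IsProjectivelyEquivalent L (graphSet fun x : K => x ^ Nat.card F ^ s)

/-- `L` is of LP type: with `q = |F|` and `n = [K : F] > 3`, it is projectively equivalent to `L_f`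
for some `f(x) = x^(q^s) + δ x^(q^(n-s))` with `gcd(s, n) = 1` and `N_{K/F}(δ) ≠ 0, 1`. -/
def IsLPType {V : Type*} [AddCommGroup V] [Module K V] (L : Set (Submodule K V)) : Prop :=
  3 < finrank F K ∧ ∃ (s : ℕ) (δ : K), s < finrank F K ∧ s.Coprime (finrank F K) ∧
    Algebra.norm F δ ≠ 0 ∧ Algebra.norm F δ ≠ 1 ∧
    IsProjectivelyEquivalent L
      (graphSet fun x : K => x ^ Nat.card F ^ s + δ * x ^ Nat.card F ^ (finrank F K - s))

end LinearSets

/-- The projection `℘_Γ(Sig)` of a set of points from the vertex `Γ` onto a complement `Λ`: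
the set of the intersections `⟨Γ, P⟩ ∩ Λ`, `P ∈ Sig`, as subspaces of `Λ`. -/
def projectFrom {K V : Type*} [Field K] [AddCommGroup V] [Module K V] (Γ Λ : Submodule K V)
    (Sig : Set (Submodule K V)) : Set (Submodule K Λ) :=
  (fun P => (Γ ⊔ P).submoduleOf Λ) '' Sig

/-! A nontrivial collineation fixing `Sig` pointwise is induced by a `τ`-semilinear map `S` of order
five, and `Sig` is the set of points of the `F₀`-space of vectors fixed by `S`. With `π` the
projection of kernel `Γ`, the linear set consists of the points `⟨π v⟩`, `S v = v ≠ 0`. A counting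
argument turns maximum scatteredness into injectivity of this projection on `Sig`.

`A` consists of the `a` with `a, S a ∈ Γ`, and `B` of the `b` with `b, S² b ∈ Γ`. Both are nonzero
by dimension. If one were larger than a point, `Γ` would contain three consecutive vectors of an
orbit of `S` or `S²`, and the linear set would be of pseudoregulus type. Scatteredness also makes
such orbits linearly independent, so `E` is a point, and `E ∈ ⟨A₂, A₄⟩` says exactly that `Γ = ⟨a, S
a, α S² a + β S⁴ a⟩` with `α, β ≠ 0` (`diagonal_point_le_iff`).

In that position the orbit of `a` is a basis, the fixed vectors are the sums of `τ^i(x) S^i a`, and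
their projections form the graph of `y ↦ τ⁻¹ y - (α/β) τ y` (`IsScatteredVertex.isLPType`). The norm
of `-(α/β)` is not 1, since norm 1 would give two points of `Sig` with the same projection.

Conversely, suppose that the linear set is equivalent to the graph of `ρ + δ ρ⁻¹`. It is then also
the graph of a linearized polynomial read off from an orbit of a power of `S` inducing `ρ`. Power
sums of the slopes force this polynomial to be a combination of `ρ` and `ρ⁻¹`
(`coeff_eq_zero_of_slopes`), and the vanishing coefficients put `Γ` in the special position for that
power of `S`. The position is invariant under inversion of `S`, so only `S` and `S²` matter. Passing
from `S` to `S²` replaces `(A, B, E)` by `(B, A₁, F)`, which yields the second condition. -/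

section CyclicQuintic

/-! ### Automorphisms and linearized polynomials of a quintic extension of finite fields. -/

variable {F₀ K : Type*} [Field F₀] [Field K] [Algebra F₀ K]

theorem exists_not_fixed {τ : K ≃ₐ[F₀] K} (hτ : τ ≠ 1) :
    ∃ c, τ c ≠ c := by
  by_contra! h
  exact hτ (AlgEquiv.ext h)

variable [Finite F₀]

theorem orderOf_eq_five (hK : finrank F₀ K = 5) {τ : K ≃ₐ[F₀] K} (hτ : τ ≠ 1) :
    orderOf τ = 5 := by
  have : FiniteDimensional F₀ K := FiniteDimensional.of_finrank_pos (by omega)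
  have : Finite K := Module.finite_of_finite F₀
  have hc : Nat.card (K ≃ₐ[F₀] K) = 5 := by rw [IsGalois.card_aut_eq_finrank, hK]
  have h := orderOf_dvd_natCard τ
  rw [hc, Nat.dvd_prime Nat.prime_five] at h
  exact h.resolve_left fun h => hτ (orderOf_eq_one_iff.1 h)

theorem pow_five_eq_one (hK : finrank F₀ K = 5) (τ : K ≃ₐ[F₀] K) : τ ^ 5 = 1 := by
  by_cases hτ : τ = 1
  · simp [hτ]
  · rw [← orderOf_eq_five hK hτ, pow_orderOf_eq_one]

theorem mem_zpowers_of_ne_one (hK : finrank F₀ K = 5) {τ : K ≃ₐ[F₀] K} (hτ : τ ≠ 1)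
    (ρ : K ≃ₐ[F₀] K) : ρ ∈ Subgroup.zpowers τ := by
  have : FiniteDimensional F₀ K := FiniteDimensional.of_finrank_pos (by omega)
  have : Finite K := Module.finite_of_finite F₀
  have hc : Nat.card (K ≃ₐ[F₀] K) = 5 := by rw [IsGalois.card_aut_eq_finrank, hK]
  have : Fact (Nat.Prime 5) := ⟨Nat.prime_five⟩
  exact mem_zpowers_of_prime_card hc hτ

theorem exists_pow_eq_of_ne_one (hK : finrank F₀ K = 5) {τ : K ≃ₐ[F₀] K} (hτ : τ ≠ 1)
    (ρ : K ≃ₐ[F₀] K) : ∃ i < 5, τ ^ i = ρ := by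
  obtain ⟨n, hn⟩ := mem_zpowers_of_ne_one hK hτ ρ
  have h5 := orderOf_eq_five hK hτ
  refine ⟨(n % 5).toNat, by omega, ?_⟩
  rw [← zpow_natCast, Int.toNat_of_nonneg (by omega), ← hn]
  have := zpow_mod_orderOf τ n
  rw [h5] at this
  exact_mod_cast this

theorem exists_algebraMap_eq_of_fixed (hK : finrank F₀ K = 5) {τ : K ≃ₐ[F₀] K} (hτ : τ ≠ 1)
    {c : K} (hc : τ c = c) : ∃ a : F₀, algebraMap F₀ K a = c := by
  have : FiniteDimensional F₀ K := FiniteDimensional.of_finrank_pos (by omega)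
  have : Finite K := Module.finite_of_finite F₀
  rw [← Set.mem_range, IsGalois.mem_range_algebraMap_iff_fixed]
  intro ρ
  obtain ⟨i, -, rfl⟩ := exists_pow_eq_of_ne_one hK hτ ρ
  induction i with
  | zero => rfl
  | succ i ih => rw [pow_succ, AlgEquiv.mul_apply, hc, ih]

theorem pow_injective_of_ne_one (hK : finrank F₀ K = 5) {τ : K ≃ₐ[F₀] K} (hτ : τ ≠ 1) :
    Function.Injective fun i : Fin 5 => τ ^ (i : ℕ) := by
  intro i j h
  have := pow_inj_mod.1 h
  rw [orderOf_eq_five hK hτ] at this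
  omega

theorem pow_bijective (hK : finrank F₀ K = 5) {τ : K ≃ₐ[F₀] K} (hτ : τ ≠ 1) :
    Function.Bijective fun i : Fin 5 => τ ^ (i : ℕ) :=
  ⟨pow_injective_of_ne_one hK hτ, fun ρ => by
    obtain ⟨i, hi, h⟩ := exists_pow_eq_of_ne_one hK hτ ρ
    exact ⟨⟨i, hi⟩, h⟩⟩

/-- The powers of `τ` are linearly independent, with coefficients in an arbitrary vector space. -/
theorem eq_zero_of_sum_pow_smul {V : Type*} [AddCommGroup V] [Module K V]
    (hK : finrank F₀ K = 5) {τ : K ≃ₐ[F₀] K} (hτ : τ ≠ 1) {p : Fin 5 → V}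
    (h : ∀ x, ∑ i : Fin 5, (τ ^ (i : ℕ)) x • p i = 0) (i : Fin 5) : p i = 0 := by
  -- Linear functionals reduce the claim to scalar coefficients, where it is Dedekind's independence
  -- of characters.
  rw [← Module.forall_dual_apply_eq_zero_iff K]
  intro f
  have hli := (linearIndependent_monoidHom K K).comp
    (fun i : Fin 5 => ((τ ^ (i : ℕ) : K ≃ₐ[F₀] K) : K →* K)) (by
      intro i j hij
      apply pow_injective_of_ne_one hK hτ
      ext x
      exact DFunLike.congr_fun hij x)
  rw [Fintype.linearIndependent_iff] at hli
  refine hli (fun i => f (p i)) ?_ i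
  ext x
  have := congrArg f (h x)
  simp only [map_sum, map_smul, smul_eq_mul, map_zero] at this
  rw [Finset.sum_apply, Pi.zero_apply, ← this]
  exact Finset.sum_congr rfl fun i _ => mul_comm _ _

/-- Every `F₀`-linear map on `K` is a linearized polynomial. -/
theorem exists_eq_sum_pow_smul {V : Type*} [AddCommGroup V] [Module K V] [Module F₀ V]
    [IsScalarTower F₀ K V]
    (hK : finrank F₀ K = 5) {τ : K ≃ₐ[F₀] K} (hτ : τ ≠ 1) (θ : K →ₗ[F₀] V) :
    ∃ p : Fin 5 → V, ∀ x, θ x = ∑ i : Fin 5, (τ ^ (i : ℕ)) x • p i := by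
  have : FiniteDimensional F₀ K := FiniteDimensional.of_finrank_pos (by omega)
  have : Finite K := Module.finite_of_finite F₀
  classical
  let b := Module.finBasis F₀ K
  let d := (Algebra.traceForm F₀ K).dualBasis (traceForm_nondegenerate F₀ K) b
  refine ⟨fun i => ∑ j, (τ ^ (i : ℕ)) (b j) • θ (d j), fun x => ?_⟩
  -- Expansion in a trace-dual basis: the coordinates of `x` are traces, and the trace is the sum of
  -- the powers of `τ`.
  have hx : x = ∑ j, Algebra.trace F₀ K (x * b j) • d j := by
    conv_lhs => rw [← d.sum_repr x]
    simp [d]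
  conv_lhs => rw [hx]
  simp only [map_sum, map_smul, Finset.smul_sum]
  rw [Finset.sum_comm]
  refine Finset.sum_congr rfl fun j _ => ?_
  rw [← algebraMap_smul K, trace_eq_sum_automorphisms, Finset.sum_smul,
    ← (Equiv.ofBijective _ (pow_bijective hK hτ)).sum_comp]
  refine Finset.sum_congr rfl fun i _ => ?_
  simp [mul_smul]

theorem exists_frobenius (hK : finrank F₀ K = 5) :
    ∃ φ : K ≃ₐ[F₀] K, φ ≠ 1 ∧ ∀ (n : ℕ) (x : K), (φ ^ n) x = x ^ Nat.card F₀ ^ n := by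
  have : FiniteDimensional F₀ K := FiniteDimensional.of_finrank_pos (by omega)
  have : Finite K := Module.finite_of_finite F₀
  have := Fintype.ofFinite F₀
  refine ⟨FiniteField.frobeniusAlgEquivOfAlgebraic F₀ K, fun h => ?_, fun n x => ?_⟩
  · have h1 := FiniteField.orderOf_frobeniusAlgEquivOfAlgebraic F₀ K
    rw [h, orderOf_one, hK] at h1
    omega
  · rw [AlgEquiv.coe_pow, FiniteField.coe_frobeniusAlgEquivOfAlgebraic_iterate,
      Nat.card_eq_fintype_card]

theorem exists_eq_pow_card_pow (hK : finrank F₀ K = 5) {τ : K ≃ₐ[F₀] K} (hτ : τ ≠ 1) :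
    ∃ s, 0 < s ∧ s < 5 ∧ (∀ x, τ x = x ^ Nat.card F₀ ^ s) ∧
      ∀ x, (τ ^ 4) x = x ^ Nat.card F₀ ^ (5 - s) := by
  obtain ⟨φ, hφ, h⟩ := exists_frobenius (F₀ := F₀) hK
  obtain ⟨s, hs, rfl⟩ := exists_pow_eq_of_ne_one hK hφ τ
  refine ⟨s, Nat.pos_of_ne_zero fun h0 => hτ (by rw [h0, pow_zero]), hs, h s, fun x => ?_⟩
  rw [← h, ← pow_mul, pow_inj_mod.2]
  rw [orderOf_eq_five hK hφ]
  omega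

theorem exists_algEquiv_eq_pow (hK : finrank F₀ K = 5) {s : ℕ} (hs0 : 0 < s) (hs : s < 5) :
    ∃ ρ : K ≃ₐ[F₀] K, ρ ≠ 1 ∧ (∀ x, ρ x = x ^ Nat.card F₀ ^ s) ∧
      ∀ x, (ρ ^ 4) x = x ^ Nat.card F₀ ^ (5 - s) := by
  obtain ⟨φ, hφ, h⟩ := exists_frobenius (F₀ := F₀) hK
  refine ⟨φ ^ s, fun h1 => ?_, h s, fun x => ?_⟩
  · have := orderOf_dvd_of_pow_eq_one h1
    rw [orderOf_eq_five hK hφ] at this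
    exact absurd (Nat.le_of_dvd hs0 this) (by omega)
  · rw [← h, ← pow_mul, pow_inj_mod.2]
    rw [orderOf_eq_five hK hφ]
    omega

theorem pow_ne_one_of_lt (hK : finrank F₀ K = 5) {τ : K ≃ₐ[F₀] K} (hτ : τ ≠ 1) {k : ℕ}
    (h0 : 0 < k) (h5 : k < 5) : τ ^ k ≠ 1 :=
  pow_ne_one_of_lt_orderOf h0.ne' (by rwa [orderOf_eq_five hK hτ])

theorem algebraMap_norm_eq (hK : finrank F₀ K = 5) {τ : K ≃ₐ[F₀] K} (hτ : τ ≠ 1) (x : K) :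
    algebraMap F₀ K (Algebra.norm F₀ x) = x * τ x * τ (τ x) * τ (τ (τ x)) * τ (τ (τ (τ x))) := by
  have : FiniteDimensional F₀ K := FiniteDimensional.of_finrank_pos (by omega)
  have : Finite K := Module.finite_of_finite F₀
  rw [Algebra.norm_eq_prod_automorphisms, ← (Equiv.ofBijective _ (pow_bijective hK hτ)).prod_comp]
  simp [Fin.prod_univ_five]

theorem apply_five (hK : finrank F₀ K = 5) (τ : K ≃ₐ[F₀] K) (x : K) :
    τ (τ (τ (τ (τ x)))) = x := by
  have := DFunLike.congr_fun (pow_five_eq_one hK τ) x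
  simpa [pow_succ] using this

/-- Hilbert 90. The vector `c + δ τ(c) + δ τ(δ) τ²(c) + ...` with five terms satisfies the equation
because the norm is 1, and by independence of the powers of `τ` it is nonzero for some `c`. -/
theorem exists_mul_apply_eq_of_norm_eq_one (hK : finrank F₀ K = 5) {τ : K ≃ₐ[F₀] K}
    (hτ : τ ≠ 1) {δ : K} (hδ : Algebra.norm F₀ δ = 1) : ∃ b, b ≠ 0 ∧ δ * τ b = b := by
  have hn := algebraMap_norm_eq hK hτ δ
  rw [hδ, map_one] at hn
  by_contra! h
  have h0 := eq_zero_of_sum_pow_smul hK hτ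
    (p := ![1, δ, δ * τ δ, δ * τ δ * τ (τ δ), δ * τ δ * τ (τ δ) * τ (τ (τ δ))]) (fun c => ?_) 0
  · exact one_ne_zero h0
  · by_contra hc
    refine h _ hc ?_
    simp only [Fin.sum_univ_five, smul_eq_mul, map_add, map_mul, pow_succ, AlgEquiv.mul_apply,
      Fin.val_zero, Fin.val_one, Fin.val_two, pow_zero, AlgEquiv.one_apply,
      Matrix.cons_val, map_one]
    simp only [Fin.isValue, Fin.coe_ofNat_eq_mod, Nat.reduceMod, pow_succ,
      pow_zero, AlgEquiv.mul_apply, AlgEquiv.one_apply, apply_five hK]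
    linear_combination (-c) * hn

/-- If `N(δ) = 1`, then the graph of `x ↦ ρ x + δ ρ⁻¹ x` is not scattered. -/
theorem exists_collision_of_norm_eq_one (hK : finrank F₀ K = 5) {ρ : K ≃ₐ[F₀] K} (hρ : ρ ≠ 1)
    {δ : K} (hδ : Algebra.norm F₀ δ = 1) :
    ∃ x t : K, x ≠ 0 ∧ t ≠ 0 ∧ ρ t ≠ t ∧
      ρ (t * x) + δ * (ρ ^ 4) (t * x) = t * (ρ x + δ * (ρ ^ 4) x) := by
  have h4 : ∀ x, (ρ ^ 4) x = ρ (ρ (ρ (ρ x))) := fun x => by simp [pow_succ]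
  have h5 := apply_five hK ρ
  obtain ⟨b, hb, hb'⟩ := exists_mul_apply_eq_of_norm_eq_one hK
    (pow_ne_one_of_lt hK hρ (k := 2) (by omega) (by omega)) hδ
  rw [pow_two, AlgEquiv.mul_apply] at hb'
  obtain ⟨t, ht⟩ := exists_not_fixed hρ
  obtain ⟨s, hs⟩ : ∃ s, s = (ρ t - t)⁻¹ := ⟨_, rfl⟩
  have hs0 : s ≠ 0 := by rw [hs]; exact inv_ne_zero (sub_ne_zero.2 ht)
  have hst : ρ t = t + s⁻¹ := by rw [hs, inv_inv]; ring
  have hne : ∀ {x}, x ≠ 0 → ρ x ≠ 0 := fun h => (map_ne_zero ρ).2 h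
  have ht0 : t ≠ 0 := fun h => ht (by simp [h])
  have hb1 := hne hb
  have hb2 := hne hb1
  have hs1 := hne hs0
  have hs2 := hne hs1
  have hs3 := hne hs2
  have hs4 := hne hs3
  have hst4 : ρ (ρ (ρ (ρ t))) = t - (ρ (ρ (ρ (ρ s))))⁻¹ := by
    have := congrArg (fun x => ρ (ρ (ρ (ρ x)))) hst
    simp only [h5, map_add, map_inv₀] at this
    exact eq_sub_of_add_eq this.symm
  have hδ' : δ = b / ρ (ρ b) := by rw [eq_div_iff hb2, hb']
  -- With `s = (ρ t - t)⁻¹` and `δ = b / ρ² b`, the required identity is `ρ x / s = δ ρ⁻¹ x / ρ⁴ s`.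
  -- For this `x` both sides equal the inverse of `ρ² b · s · ρ² s · ρ⁴ s`.
  refine ⟨(ρ b)⁻¹ * (ρ s * ρ (ρ (ρ s)))⁻¹, t, ?_, ht0, ht, ?_⟩
  · exact mul_ne_zero (inv_ne_zero hb1) (inv_ne_zero (mul_ne_zero hs1 hs3))
  · simp only [h4, map_mul, map_inv₀, h5, hst4, hδ']
    rw [hst]
    field_simp
    ring

end CyclicQuintic

/-! ### Power sums of the slopes of a linearized polynomial. -/

section PowerSums

theorem sum_map_pow_eq_sum_count (q : ℕ) (l : List (Fin 5)) :
    (l.map fun d : Fin 5 => q ^ (d : ℕ)).sum = ∑ d : Fin 5, l.count d * q ^ (d : ℕ) := by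
  induction l with
  | nil => simp
  | cons a l ih =>
    simp only [List.map_cons, List.sum_cons, ih, List.count_cons, add_mul, Finset.sum_add_distrib]
    rw [add_comm]
    simp

/-- Sums of at most three powers of `q ≥ 4` with exponents below `5` are determined by their
residue modulo `q ^ 5 - 1`. -/
theorem perm_of_sum_pow_modEq {q : ℕ} (hq : 4 ≤ q) {l l' : List (Fin 5)} (hl : l.length ≤ 3)
    (hl' : l'.length ≤ 3)
    (h : (l.map fun d : Fin 5 => q ^ (d : ℕ)).sum ≡ (l'.map fun d : Fin 5 => q ^ (d : ℕ)).sum [MOD q ^ 5 - 1]) :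
    l.Perm l' := by
  have hlt : ∀ l : List (Fin 5), l.length ≤ 3 →
      (l.map fun d : Fin 5 => q ^ (d : ℕ)).sum < q ^ 5 - 1 := fun l hl => by
    have h1 : (l.map fun d : Fin 5 => q ^ (d : ℕ)).sum ≤ l.length * q ^ 4 := by
      have := List.sum_le_card_nsmul (l.map fun d : Fin 5 => q ^ (d : ℕ)) (q ^ 4) (by
        intro x hx
        obtain ⟨d, -, rfl⟩ := List.mem_map.1 hx
        exact Nat.pow_le_pow_right (by omega) (by omega))
      simpa using this
    have h2 : 4 * q ^ 4 ≤ q ^ 5 := by rw [pow_succ' q 4]; exact Nat.mul_le_mul_right _ hq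
    have h3 : l.length * q ^ 4 ≤ 3 * q ^ 4 := Nat.mul_le_mul_right _ hl
    have h4 : 4 ^ 4 ≤ q ^ 4 := Nat.pow_le_pow_left hq 4
    omega
  have h1 := h.eq_of_lt_of_lt (hlt l hl) (hlt l' hl')
  rw [sum_map_pow_eq_sum_count, sum_map_pow_eq_sum_count] at h1
  -- Each multiplicity is at most `3 < q`, so the multiplicities are the base `q` digits of the sum.
  have h2 := Nat.ofDigits_inj_of_len_eq (b := q) (by omega)
    (L1 := List.ofFn fun d : Fin 5 => l.count d) (L2 := List.ofFn fun d : Fin 5 => l'.count d)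
    (by simp)
    (fun x hx => by
      obtain ⟨d, rfl⟩ := (List.mem_ofFn' _ _).1 hx
      exact (List.count_le_length.trans hl).trans_lt (by omega))
    (fun x hx => by
      obtain ⟨d, rfl⟩ := (List.mem_ofFn' _ _).1 hx
      exact (List.count_le_length.trans hl').trans_lt (by omega))
    (by
      simp only [Fin.sum_univ_five] at h1
      simp only [List.ofFn_succ, List.ofFn_zero, Nat.ofDigits_cons, Nat.ofDigits_nil]
      simp only [Fin.isValue, Fin.coe_ofNat_eq_mod,
        Nat.reduceMod] at h1
      push_cast
      linarith)
  rw [List.perm_iff_count]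
  exact fun d => congrFun (List.ofFn_injective h2) d

/-- The factor `m` accounts for `ρ` being the `m`-th power of Frobenius, so that `ρ^i` has exponent
`q ^ (m * i)`. Repeated digits may carry when `q` is 2 or 3; these cases are finite checks. -/
theorem perm_of_pow_add_pow_modEq {q : ℕ} (hq : 2 ≤ q) {m i j l : Fin 5} (hm : m ≠ 0)
    (hl : l ≠ 0)
    (h : q ^ (m * i : Fin 5).val + q ^ (m * j : Fin 5).val ≡ 1 + q ^ (m * l : Fin 5).val
      [MOD q ^ 5 - 1]) : [i, j].Perm [0, l] := by
  obtain rfl | rfl | hq : q = 2 ∨ q = 3 ∨ 4 ≤ q := by omega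
  · unfold Nat.ModEq at h; revert m i j l; decide
  · unfold Nat.ModEq at h; revert m i j l; decide
  · have := perm_of_sum_pow_modEq hq (l := [m * i, m * j]) (l' := [0, m * l]) (by simp) (by simp)
      (by simpa using h)
    clear h; revert m i j l; decide

theorem perm_of_pow_add_pow_add_pow_modEq {q : ℕ} (hq : 2 ≤ q) {m i j k : Fin 5} (hm : m ≠ 0)
    (h : q ^ (m * i : Fin 5).val + q ^ (m * j : Fin 5).val + q ^ (m * k : Fin 5).val ≡
      1 + q ^ m.val + q ^ (m * 2 : Fin 5).val [MOD q ^ 5 - 1]) : [i, j, k].Perm [0, 1, 2] := by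
  obtain rfl | rfl | hq : q = 2 ∨ q = 3 ∨ 4 ≤ q := by omega
  · unfold Nat.ModEq at h; revert m i j k; decide
  · unfold Nat.ModEq at h; revert m i j k; decide
  · have := perm_of_sum_pow_modEq hq (l := [m * i, m * j, m * k]) (l' := [0, m, m * 2])
      (by simp) (by simp) (by simpa [add_assoc] using h)
    clear h; revert m i j k; decide

variable {F₀ K : Type*} [Field F₀] [Field K] [Algebra F₀ K]

/-- The multiset of slopes of a scattered graph is determined by the set of slopes. -/
theorem sum_units_slope_eq [Fintype Kˣ] {M : Type*} [AddCommMonoid M] {f g : K →ₗ[F₀] K}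
    (hf : ∀ x y : K, x ≠ 0 → y ≠ 0 → f x / x = f y / y → ∃ c : F₀, y = c • x)
    (hfg : ∀ x : K, x ≠ 0 → ∃ y, y ≠ 0 ∧ f x / x = g y / y) (h : K → M) :
    ∑ x : Kˣ, h (f x / x) = ∑ x : Kˣ, h (g x / x) := by
  classical
  choose! ψ hψ0 hψ using hfg
  have hrep : ∀ x : Kˣ, ∃ (c : F₀ˣ) (r : Kˣ), (x : K) = c • (r : K) ∧
      (r : K) = (Projectivization.mk F₀ (x : K) x.ne_zero).rep := fun x => by
    obtain ⟨c, hc⟩ := Projectivization.exists_smul_eq_mk_rep F₀ (x : K) x.ne_zero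
    refine ⟨c⁻¹, Units.mk0 _ (Projectivization.rep_nonzero _), ?_, rfl⟩
    rw [Units.val_mk0, ← hc, inv_smul_smul]
  choose c r hx hr using hrep
  have hslope : ∀ (f : K →ₗ[F₀] K) (c : F₀ˣ) (y : K), f (c • y) / (c • y) = f y / y := by
    intro f c y
    rw [Units.smul_def, map_smul, Algebra.smul_def, Algebra.smul_def, mul_div_mul_left]
    exact (map_ne_zero _).2 c.ne_zero
  -- A slope-preserving self-map of the units: a slope partner is chosen for one representative of
  -- each `F₀`-point and extended by scalars. Scatteredness of `f` makes it injective, hence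
  -- bijective, so inclusion of the slope sets suffices.
  let π : Kˣ → Kˣ := fun x => Units.mk0 (c x • ψ (r x))
    ((smul_ne_zero_iff_ne _).2 (hψ0 _ (r x).ne_zero))
  have hπ : ∀ x, g (π x) / π x = f x / x := fun x => by
    simp only [π, Units.val_mk0]
    rw [hslope, ← hψ _ (r x).ne_zero]
    conv_rhs => rw [hx x]
    rw [hslope]
  have hinj : Function.Injective π := fun x y hxy => by
    have h1 : f x / x = f y / y := by rw [← hπ, ← hπ, hxy]
    obtain ⟨d, hd⟩ := hf x y x.ne_zero y.ne_zero h1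
    have h2 : (r x : K) = r y := by
      rw [hr, hr]
      congr 1
      rw [Projectivization.mk_eq_mk_iff']
      exact ⟨d⁻¹, by rw [hd, inv_smul_smul₀ (fun h => y.ne_zero (by rw [hd, h, zero_smul]))]⟩
    have h3 : (c x • ψ (r x) : K) = c y • ψ (r y) := congrArg Units.val hxy
    rw [h2] at h3
    have h4 : c x = c y := by
      ext
      exact smul_left_injective F₀ (hψ0 _ (r y).ne_zero) h3
    ext
    rw [hx x, hx y, h2, h4]
  have hbij := Finite.injective_iff_bijective.1 hinj
  rw [← (Equiv.ofBijective π hbij).sum_comp (fun x : Kˣ => h (g x / x))]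
  exact Finset.sum_congr rfl fun x _ => by rw [Equiv.ofBijective_apply, hπ]

variable [Finite F₀]

/-- The summand is a character of the cyclic group of units. Its sum vanishes unless it is trivial,
and then it is the order of the group, which is `-1` in `K`. -/
theorem sum_units_pow_div_pow {K : Type*} [Field K] [Finite K] [Fintype Kˣ] (a b : ℕ)
    [Decidable (a ≡ b [MOD Nat.card K - 1])] :
    ∑ x : Kˣ, (x : K) ^ a / (x : K) ^ b = if a ≡ b [MOD Nat.card K - 1] then -1 else 0 := by
  classical
  have h := sum_hom_units ((Units.coeHom K).comp (powMonoidHom (α := Kˣ) a / powMonoidHom b))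
  have hiff : (Units.coeHom K).comp (powMonoidHom (α := Kˣ) a / powMonoidHom b) = 1 ↔
      a ≡ b [MOD Nat.card K - 1] := by
    obtain ⟨g, hg⟩ := IsCyclic.exists_generator (α := Kˣ)
    have ho : orderOf g = Nat.card K - 1 := by
      rw [orderOf_eq_card_of_forall_mem_zpowers hg, Nat.card_units]
    rw [← ho, ← pow_eq_pow_iff_modEq]
    constructor
    · intro h
      have := DFunLike.congr_fun h g
      exact div_eq_one.1 (Units.ext this)
    · intro h
      ext x
      obtain ⟨n, rfl⟩ := hg x
      have : (g ^ n) ^ a = (g ^ n) ^ b := by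
        rw [← zpow_natCast, ← zpow_natCast, zpow_comm g, zpow_comm g n, zpow_natCast, zpow_natCast, h]
      simp [this]
  have hc : ((Fintype.card Kˣ : ℕ) : K) = -1 := by
    have := Fintype.ofFinite K
    rw [← Nat.card_eq_fintype_card, Nat.card_units, Nat.card_eq_fintype_card,
      Nat.cast_sub Fintype.card_pos, Nat.cast_one]
    simp
  simp only [hiff, Nat.cast_ite, hc, Nat.cast_zero] at h
  rw [← h]
  refine Finset.sum_congr rfl fun x _ => ?_
  simp

theorem exists_pow_eq_pow_card_pow (hK : finrank F₀ K = 5) {ρ : K ≃ₐ[F₀] K} (hρ : ρ ≠ 1) :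
    ∃ m : Fin 5, m ≠ 0 ∧ ∀ (i : Fin 5) (x : K),
      (ρ ^ (i : ℕ)) x = x ^ Nat.card F₀ ^ (m * i : Fin 5).val := by
  obtain ⟨φ, hφ, h⟩ := exists_frobenius (F₀ := F₀) hK
  obtain ⟨m, hm, rfl⟩ := exists_pow_eq_of_ne_one hK hφ ρ
  refine ⟨⟨m, hm⟩, fun h0 => hρ ?_, fun i x => ?_⟩
  · rw [Fin.mk_eq_zero.1 h0, pow_zero]
  · rw [← h, ← pow_mul, Fin.val_mul, pow_inj_mod.2]
    rw [orderOf_eq_five hK hφ, Nat.mod_mod]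

variable [Fintype Kˣ]

theorem sum_units_one (hK : finrank F₀ K = 5) {ρ : K ≃ₐ[F₀] K} (hρ : ρ ≠ 1) (i : Fin 5) :
    ∑ x : Kˣ, (ρ ^ (i : ℕ)) (x : K) / x = if i = 0 then -1 else 0 := by
  classical
  have : FiniteDimensional F₀ K := FiniteDimensional.of_finrank_pos (by omega)
  have : Finite K := Module.finite_of_finite F₀
  obtain ⟨m, hm, h⟩ := exists_pow_eq_pow_card_pow hK hρ
  have h1 := sum_units_pow_div_pow (K := K) (Nat.card F₀ ^ (m * i : Fin 5).val) 1
  simp only [h, pow_one] at h1 ⊢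
  rw [h1]
  refine if_congr ⟨fun hmod => ?_, ?_⟩ rfl rfl
  · rw [Module.natCard_eq_pow_finrank (K := F₀), hK] at hmod
    have hq : 1 < Nat.card F₀ := Finite.one_lt_card
    -- Adding the same power to both sides reduces the one-term congruence to the two-term one.
    have hp := perm_of_pow_add_pow_modEq hq (l := 1) (j := 1) hm (by decide)
      (hmod.add_right (Nat.card F₀ ^ (m * 1 : Fin 5).val))
    clear hmod h1; revert i; decide
  · rintro rfl
    simp [Nat.ModEq.refl]

theorem sum_units_two (hK : finrank F₀ K = 5) {ρ : K ≃ₐ[F₀] K} (hρ : ρ ≠ 1) {i j l : Fin 5}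
    (hl : l ≠ 0) :
    ∑ x : Kˣ, (ρ ^ (i : ℕ)) (x : K) * (ρ ^ (j : ℕ)) (x : K) / (x * (ρ ^ (l : ℕ)) (x : K)) =
      if [i, j].Perm [0, l] then -1 else 0 := by
  classical
  have : FiniteDimensional F₀ K := FiniteDimensional.of_finrank_pos (by omega)
  have : Finite K := Module.finite_of_finite F₀
  obtain ⟨m, hm, h⟩ := exists_pow_eq_pow_card_pow hK hρ
  have h1 := sum_units_pow_div_pow (K := K)
    (Nat.card F₀ ^ (m * i : Fin 5).val + Nat.card F₀ ^ (m * j : Fin 5).val)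
    (1 + Nat.card F₀ ^ (m * l : Fin 5).val)
  simp only [h, pow_add, pow_one] at h1 ⊢
  rw [h1]
  refine if_congr ⟨fun hmod => ?_, fun hp => ?_⟩ rfl rfl
  · rw [Module.natCard_eq_pow_finrank (K := F₀), hK] at hmod
    exact perm_of_pow_add_pow_modEq Finite.one_lt_card hm hl hmod
  · have := (hp.map fun i : Fin 5 => Nat.card F₀ ^ (m * i : Fin 5).val).sum_eq
    simp only [List.map_cons, List.map_nil, List.sum_cons, List.sum_nil, mul_zero, add_zero,
      Fin.val_zero, pow_zero] at this
    rw [this]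

theorem sum_units_three (hK : finrank F₀ K = 5) {ρ : K ≃ₐ[F₀] K} (hρ : ρ ≠ 1) (i j k : Fin 5) :
    ∑ x : Kˣ, (ρ ^ (i : ℕ)) (x : K) * (ρ ^ (j : ℕ)) (x : K) * (ρ ^ (k : ℕ)) (x : K) /
      (x * ρ x * (ρ ^ 2) (x : K)) = if [i, j, k].Perm [0, 1, 2] then -1 else 0 := by
  classical
  have : FiniteDimensional F₀ K := FiniteDimensional.of_finrank_pos (by omega)
  have : Finite K := Module.finite_of_finite F₀
  obtain ⟨m, hm, h⟩ := exists_pow_eq_pow_card_pow hK hρ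
  have h1 := sum_units_pow_div_pow (K := K)
    (Nat.card F₀ ^ (m * i : Fin 5).val + Nat.card F₀ ^ (m * j : Fin 5).val +
      Nat.card F₀ ^ (m * k : Fin 5).val)
    (1 + Nat.card F₀ ^ m.val + Nat.card F₀ ^ (m * 2 : Fin 5).val)
  have e1 : ∀ x : K, ρ x = x ^ Nat.card F₀ ^ m.val := fun x => by simpa using h 1 x
  have e2 : ∀ x : K, (ρ ^ 2) x = x ^ Nat.card F₀ ^ (m * 2 : Fin 5).val := fun x => h 2 x
  simp only [e1, e2, h, pow_add, pow_one] at h1 ⊢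
  rw [h1]
  refine if_congr ⟨fun hmod => ?_, fun hp => ?_⟩ rfl rfl
  · rw [Module.natCard_eq_pow_finrank (K := F₀), hK] at hmod
    exact perm_of_pow_add_pow_add_pow_modEq Finite.one_lt_card hm hmod
  · have := (hp.map fun i : Fin 5 => Nat.card F₀ ^ (m * i : Fin 5).val).sum_eq
    simp only [List.map_cons, List.map_nil, List.sum_cons, List.sum_nil, mul_zero, add_zero,
      Fin.val_zero, pow_zero, mul_one] at this
    rw [add_assoc, this, add_assoc]

theorem sum_units_linear (hK : finrank F₀ K = 5) {ρ : K ≃ₐ[F₀] K} (hρ : ρ ≠ 1) (a : Fin 5 → K) :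
    ∑ x : Kˣ, (∑ i : Fin 5, (ρ ^ (i : ℕ)) (x : K) * a i) / x = -a 0 := by
  simp only [Finset.sum_div, mul_div_right_comm]
  rw [Finset.sum_comm]
  simp only [← Finset.sum_mul, sum_units_one hK hρ]
  simp

theorem sum_units_bilinear (hK : finrank F₀ K = 5) {ρ : K ≃ₐ[F₀] K} (hρ : ρ ≠ 1)
    (a b : Fin 5 → K) {l : Fin 5} (hl : l ≠ 0) :
    ∑ x : Kˣ, (∑ i : Fin 5, (ρ ^ (i : ℕ)) (x : K) * a i) *
      (∑ i : Fin 5, (ρ ^ (i : ℕ)) (x : K) * b i) / (x * (ρ ^ (l : ℕ)) (x : K)) =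
      -(a 0 * b l + a l * b 0) := by
  have h : ∀ x : Kˣ, (∑ i : Fin 5, (ρ ^ (i : ℕ)) (x : K) * a i) *
      (∑ i : Fin 5, (ρ ^ (i : ℕ)) (x : K) * b i) / (x * (ρ ^ (l : ℕ)) (x : K)) =
      ∑ i : Fin 5, ∑ j : Fin 5, (ρ ^ (i : ℕ)) (x : K) * (ρ ^ (j : ℕ)) (x : K) /
        (x * (ρ ^ (l : ℕ)) (x : K)) * (a i * b j) := fun x => by
    rw [Finset.sum_mul_sum, Finset.sum_div]
    refine Finset.sum_congr rfl fun i _ => ?_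
    rw [Finset.sum_div]
    refine Finset.sum_congr rfl fun j _ => ?_
    ring
  simp only [h]
  rw [Finset.sum_comm]
  simp only [Finset.sum_comm (s := (Finset.univ : Finset Kˣ)), ← Finset.sum_mul,
    sum_units_two hK hρ hl]
  fin_cases l
  · exact absurd rfl hl
  all_goals
    simp [Fin.sum_univ_five, show ∀ i j l : Fin 5, [i, j].Perm [0, l] ↔
      i = 0 ∧ j = l ∨ i = l ∧ j = 0 by decide]
    ring

theorem sum_units_trilinear (hK : finrank F₀ K = 5) {ρ : K ≃ₐ[F₀] K} (hρ : ρ ≠ 1)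
    (a b c : Fin 5 → K) :
    ∑ x : Kˣ, (∑ i : Fin 5, (ρ ^ (i : ℕ)) (x : K) * a i) *
      (∑ i : Fin 5, (ρ ^ (i : ℕ)) (x : K) * b i) *
      (∑ i : Fin 5, (ρ ^ (i : ℕ)) (x : K) * c i) / (x * ρ x * (ρ ^ 2) (x : K)) =
      -(a 0 * b 1 * c 2 + a 0 * b 2 * c 1 + a 1 * b 0 * c 2 + a 1 * b 2 * c 0 +
        a 2 * b 0 * c 1 + a 2 * b 1 * c 0) := by
  have h : ∀ x : Kˣ, (∑ i : Fin 5, (ρ ^ (i : ℕ)) (x : K) * a i) *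
      (∑ i : Fin 5, (ρ ^ (i : ℕ)) (x : K) * b i) *
      (∑ i : Fin 5, (ρ ^ (i : ℕ)) (x : K) * c i) / (x * ρ x * (ρ ^ 2) (x : K)) =
      ∑ i : Fin 5, ∑ j : Fin 5, ∑ k : Fin 5, (ρ ^ (i : ℕ)) (x : K) * (ρ ^ (j : ℕ)) (x : K) *
        (ρ ^ (k : ℕ)) (x : K) / (x * ρ x * (ρ ^ 2) (x : K)) * (a i * b j * c k) := fun x => by
    rw [Finset.sum_mul_sum, Finset.sum_mul, Finset.sum_div]
    refine Finset.sum_congr rfl fun i _ => ?_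
    rw [Finset.sum_mul_sum, Finset.sum_div]
    refine Finset.sum_congr rfl fun j _ => ?_
    rw [Finset.sum_div]
    refine Finset.sum_congr rfl fun k _ => ?_
    ring
  simp only [h]
  rw [Finset.sum_comm]
  simp only [Finset.sum_comm (s := (Finset.univ : Finset Kˣ)), ← Finset.sum_mul,
    sum_units_three hK hρ]
  simp [Fin.sum_univ_five, show ∀ i j k : Fin 5, [i, j, k].Perm [0, 1, 2] ↔
      i = 0 ∧ j = 1 ∧ k = 2 ∨ i = 0 ∧ j = 2 ∧ k = 1 ∨ i = 1 ∧ j = 0 ∧ k = 2 ∨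
      i = 1 ∧ j = 2 ∧ k = 0 ∨ i = 2 ∧ j = 0 ∧ k = 1 ∨ i = 2 ∧ j = 1 ∧ k = 0 by decide]
  ring

/-- Composing `f` with `ρ` applies `ρ` to the coefficients and shifts them cyclically. After
expansion, only the monomials whose exponents match those of the denominator contribute. -/
theorem sum_units_slopes (hK : finrank F₀ K = 5) {ρ : K ≃ₐ[F₀] K} (hρ : ρ ≠ 1)
    {f : K → K} {a : Fin 5 → K} (hfa : ∀ x, f x = ∑ i : Fin 5, (ρ ^ (i : ℕ)) x * a i) :
    ∑ x : Kˣ, f x / x = -a 0 ∧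
    ∑ x : Kˣ, f x / x * ρ (f x / x) = -(a 0 * ρ (a 0) + a 1 * ρ (a 4)) ∧
    ∑ x : Kˣ, f x / x * ρ (ρ (f x / x)) = -(a 0 * ρ (ρ (a 0)) + a 2 * ρ (ρ (a 3))) ∧
    ∑ x : Kˣ, f x / x * ρ (f x / x) * ρ (ρ (f x / x)) =
      -(a 0 * ρ (a 0) * ρ (ρ (a 0)) + a 0 * ρ (a 1) * ρ (ρ (a 4)) + a 1 * ρ (a 4) * ρ (ρ (a 0)) +
        a 1 * ρ (a 1) * ρ (ρ (a 3)) + a 2 * ρ (a 4) * ρ (ρ (a 4)) +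
        a 2 * ρ (a 0) * ρ (ρ (a 3))) := by
  have h5 := apply_five hK ρ
  have shift : ∀ (b : Fin 5 → K) (f : K → K), (∀ x, f x = ∑ i : Fin 5, (ρ ^ (i : ℕ)) x * b i) →
      ∀ x, ρ (f x) = ∑ i : Fin 5, (ρ ^ (i : ℕ)) x *
        (![ρ (b 4), ρ (b 0), ρ (b 1), ρ (b 2), ρ (b 3)] : Fin 5 → K) i := fun b f hb x => by
    rw [hb]
    simp [Fin.sum_univ_five, h5]
    ring
  have h1 := shift _ _ hfa
  have h2 : ∀ x, ρ (ρ (f x)) = ∑ i : Fin 5, (ρ ^ (i : ℕ)) x * (![ρ (ρ (a 3)), ρ (ρ (a 4)),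
      ρ (ρ (a 0)), ρ (ρ (a 1)), ρ (ρ (a 2))] : Fin 5 → K) i := shift _ _ h1
  have e1 : ∀ x : K, (ρ ^ (1 : Fin 5).val) x = ρ x := fun x => by simp
  have e2 : ∀ x : K, (ρ ^ (2 : Fin 5).val) x = ρ (ρ x) := fun x => by simp [pow_succ]
  have e2' : ∀ x : K, (ρ ^ 2) x = ρ (ρ x) := fun x => by simp [pow_succ]
  have b1 := fun a b : Fin 5 → K => sum_units_bilinear hK hρ a b (l := 1) (by decide)
  have b2 := fun a b : Fin 5 → K => sum_units_bilinear hK hρ a b (l := 2) (by decide)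
  have b3 := sum_units_trilinear hK hρ
  simp only [e1, e2, e2'] at b1 b2 b3
  refine ⟨?_, ?_, ?_, ?_⟩
  · simp only [hfa, sum_units_linear hK hρ]
  · have := b1 a ![ρ (a 4), ρ (a 0), ρ (a 1), ρ (a 2), ρ (a 3)]
    simp only [← hfa, ← h1] at this
    simp only [map_div₀, div_mul_div_comm, this]
    simp
  · have := b2 a ![ρ (ρ (a 3)), ρ (ρ (a 4)), ρ (ρ (a 0)), ρ (ρ (a 1)), ρ (ρ (a 2))]
    simp only [← hfa, ← h2] at this
    simp only [map_div₀, div_mul_div_comm, this]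
    simp
  · have := b3 a ![ρ (a 4), ρ (a 0), ρ (a 1), ρ (a 2), ρ (a 3)]
      ![ρ (ρ (a 3)), ρ (ρ (a 4)), ρ (ρ (a 0)), ρ (ρ (a 1)), ρ (ρ (a 2))]
    simp only [← hfa, ← h1, ← h2] at this
    simp only [map_div₀, div_mul_div_comm, this]
    simp

/-- A scattered linearized polynomial having the same slopes as `x ↦ ρ x + δ ρ⁻¹ x` is a
combination of `ρ` and `ρ⁻¹`. -/
theorem coeff_eq_zero_of_slopes (hK : finrank F₀ K = 5) {ρ : K ≃ₐ[F₀] K} (hρ : ρ ≠ 1)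
    {δ : K} (hδ : δ ≠ 0) {f : K →ₗ[F₀] K} {a : Fin 5 → K}
    (hfa : ∀ x, f x = ∑ i : Fin 5, (ρ ^ (i : ℕ)) x * a i)
    (hf : ∀ x y : K, x ≠ 0 → y ≠ 0 → f x / x = f y / y → ∃ c : F₀, y = c • x)
    (hfg : ∀ x : K, x ≠ 0 → ∃ y, y ≠ 0 ∧ f x / x = (ρ y + δ * (ρ ^ 4) y) / y) :
    a 0 = 0 ∧ a 2 = 0 ∧ a 3 = 0 := by
  have : FiniteDimensional F₀ K := FiniteDimensional.of_finrank_pos (by omega)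
  let g : K →ₗ[F₀] K := ρ.toLinearMap + (LinearMap.mulLeft F₀ δ) ∘ₗ (ρ ^ 4).toLinearMap
  have hg : ∀ x, g x = ρ x + δ * (ρ ^ 4) x := fun x => by simp [g]
  have hga : ∀ x, g x = ∑ i : Fin 5, (ρ ^ (i : ℕ)) x * (![0, 1, 0, 0, δ] : Fin 5 → K) i := fun x => by
    rw [hg]; simp [Fin.sum_univ_five, mul_comm]
  have hsum := sum_units_slope_eq (M := K) hf (g := g) (by simpa only [hg] using hfg)
  obtain ⟨f1, f2, f3, f4⟩ := sum_units_slopes hK hρ hfa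
  obtain ⟨g1, g2, g3, g4⟩ := sum_units_slopes hK hρ hga
  have s1 := hsum id
  have s2 := hsum fun v => v * ρ v
  have s3 := hsum fun v => v * ρ (ρ v)
  have s4 := hsum fun v => v * ρ v * ρ (ρ v)
  simp only [id] at s1
  rw [f1, g1] at s1
  have h0 : a 0 = 0 := by simpa using s1
  rw [f2, g2] at s2
  rw [f3, g3] at s3
  rw [f4, g4] at s4
  simp [h0] at s2 s3 s4
  have h1 : a 1 ≠ 0 := fun h => hδ (by simpa [h] using s2.symm)
  have h4 : a 4 ≠ 0 := fun h => hδ (by simpa [h] using s2.symm)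
  -- The third sum gives `a 2 = 0` or `a 3 = 0`. As `a 1` and `a 4` are nonzero, the cubic sum then
  -- kills the other one.
  rcases s3 with h | h <;> simpa [h, h0, h1, h4] using s4

end PowerSums

/-! ### Semilinear maps of order five, their fixed vectors and scattered vertices. -/

section Twist

variable {F₀ K V : Type*} [Field F₀] [Field K] [AddCommGroup V] [Module K V] [Module F₀ V]

/-- The span of the first `n` vectors of the orbit of `a`. -/
def orbitSpan (K : Type*) {V : Type*} [Field K] [AddCommGroup V]
    [Module K V] [Module F₀ V] (S : V ≃ₗ[F₀] V) (a : V) (n : ℕ) : Submodule K V :=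
  Submodule.span K (Set.range fun i : Fin n => (S ^ (i : ℕ)) a)

theorem pow_mem_orbitSpan {S : V ≃ₗ[F₀] V} (a : V) {i n : ℕ} (h : i < n) : (S ^ i) a ∈ orbitSpan K S a n :=
  Submodule.subset_span ⟨⟨i, h⟩, rfl⟩

theorem orbitSpan_le {S : V ≃ₗ[F₀] V} {a : V} {n : ℕ} {M : Submodule K V} (h : ∀ i < n, (S ^ i) a ∈ M) :
    orbitSpan K S a n ≤ M := by
  rw [orbitSpan, Submodule.span_le]
  rintro _ ⟨i, rfl⟩
  exact h i i.2

variable [Algebra F₀ K]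

/-- `S` is a `τ`-semilinear map of order five inducing the collineation `σ`. -/
structure IsTwist (τ : K ≃ₐ[F₀] K) (S : V ≃ₗ[F₀] V) (σ : Submodule K V ≃o Submodule K V) :
    Prop where
  ne_one : τ ≠ 1
  map_smul : ∀ (c : K) (v : V), S (c • v) = τ c • S v
  apply_five : ∀ v, S (S (S (S (S v)))) = v
  mem_iff : ∀ (M : Submodule K V) (v : V), S v ∈ σ M ↔ v ∈ M

/-- `Γ` is a plane of a four-dimensional projective space, and the points fixed by `S` are
projected from `Γ` onto a scattered linear set. -/
structure IsScatteredVertex (K : Type*) {V : Type*} [Field K] [Algebra F₀ K] [AddCommGroup V]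
    [Module K V] [Module F₀ V] (S : V ≃ₗ[F₀] V) (Γ : Submodule K V) : Prop where
  finrank_eq : finrank K Γ = 3
  eq_zero : ∀ x ∈ Γ, S x = x → x = 0
  scattered : ∀ x y, S x = x → S y = y → x ≠ 0 → ∀ c : K, y - c • x ∈ Γ → ∃ b : F₀, y = b • x

variable {τ : K ≃ₐ[F₀] K} {S : V ≃ₗ[F₀] V} {σ : Submodule K V ≃o Submodule K V}
  {Γ : Submodule K V}

namespace IsTwist

theorem pow_apply_mem_iff (h : IsTwist τ S σ) (n : ℕ) (M : Submodule K V) (v : V) :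
    (S ^ n) v ∈ (σ ^ n) M ↔ v ∈ M := by
  induction n with
  | zero => rfl
  | succ n ih => rw [pow_succ', pow_succ', RelIso.mul_apply, LinearEquiv.mul_apply, h.mem_iff, ih]

theorem pow_smul (h : IsTwist τ S σ) (n : ℕ) (c : K) (v : V) :
    (S ^ n) (c • v) = (τ ^ n) c • (S ^ n) v := by
  induction n with
  | zero => rfl
  | succ n ih => simp only [pow_succ', LinearEquiv.mul_apply, AlgEquiv.mul_apply, ih, h.map_smul]

theorem pow_five (h : IsTwist τ S σ) : S ^ 5 = 1 := by
  ext v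
  simpa [pow_succ] using h.apply_five v

theorem collineation_pow_five (h : IsTwist τ S σ) : σ ^ 5 = 1 := by
  ext M v
  have := h.pow_apply_mem_iff 5 M v
  rwa [h.pow_five] at this

/-- A nontrivial power of a twist is a twist. -/
theorem pow [Finite F₀] (hK : finrank F₀ K = 5) (h : IsTwist τ S σ) {k : ℕ} (h0 : 0 < k)
    (h5 : k < 5) : IsTwist (τ ^ k) (S ^ k) (σ ^ k) where
  ne_one := pow_ne_one_of_lt hK h.ne_one h0 h5
  map_smul := h.pow_smul k
  apply_five v := by
    have : (S ^ k) ^ 5 = 1 := by rw [← pow_mul, mul_comm, pow_mul, h.pow_five, one_pow]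
    have := LinearEquiv.congr_fun this v
    simpa [pow_succ _ 4, pow_succ _ 3, pow_succ _ 2, pow_two] using this
  mem_iff := h.pow_apply_mem_iff k

theorem pow_apply_eq_self_iff (h : IsTwist τ S σ) {k : ℕ} (h0 : 0 < k) (h5 : k < 5) (v : V) :
    (S ^ k) v = v ↔ S v = v := by
  constructor
  · intro hv
    have hn : ∀ n, (S ^ (k * n)) v = v := fun n => by
      rw [pow_mul]
      induction n with
      | zero => rfl
      | succ n ih => rw [pow_succ, LinearEquiv.mul_apply, hv, ih]
    -- `n` is an inverse of `k` modulo 5.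
    obtain ⟨n, m, hnm⟩ : ∃ n m, k * n = 5 * m + 1 := by
      interval_cases k
      exacts [⟨1, 0, rfl⟩, ⟨3, 1, rfl⟩, ⟨2, 1, rfl⟩, ⟨4, 3, rfl⟩]
    have := hn n
    rwa [hnm, pow_succ, pow_mul, h.pow_five, one_pow, one_mul] at this
  · intro hv
    clear h0 h5
    induction k with
    | zero => rfl
    | succ n ih => rw [pow_succ, LinearEquiv.mul_apply, hv, ih]

theorem finrank_apply (h : IsTwist τ S σ) (M : Submodule K V) : finrank K (σ M) = finrank K M := by
  let e : M ≃+ σ M :=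
    { toFun := fun v => ⟨S v, (h.mem_iff M v).2 v.2⟩
      invFun := fun v => ⟨S.symm v, (h.mem_iff M _).1 (by simp)⟩
      left_inv := fun v => by simp
      right_inv := fun v => by simp
      map_add' := fun v w => by ext; simp }
  have := rank_eq_of_equiv_equiv (R := K) (R' := K) τ e τ.bijective fun c v => by
    ext; simp [e, h.map_smul]
  exact (congrArg Cardinal.toNat this).symm

theorem apply_span_singleton (h : IsTwist τ S σ) (v : V) :
    σ (Submodule.span K {v}) = Submodule.span K {S v} := by
  ext w
  obtain ⟨w, rfl⟩ := S.surjective w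
  rw [h.mem_iff, Submodule.mem_span_singleton, Submodule.mem_span_singleton]
  constructor
  · rintro ⟨c, rfl⟩
    exact ⟨τ c, (h.map_smul c v).symm⟩
  · rintro ⟨c, hc⟩
    refine ⟨τ.symm c, S.injective ?_⟩
    rw [h.map_smul, AlgEquiv.apply_symm_apply, hc]

/-- Invariant subspaces are spanned by fixed vectors. -/
theorem le_span_fixed [Finite F₀] (hK : finrank F₀ K = 5) (h : IsTwist τ S σ)
    {M : Submodule K V} (hM : ∀ v ∈ M, S v ∈ M) :
    M ≤ Submodule.span K {x | x ∈ M ∧ S x = x} := by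
  intro v hv
  rw [← Submodule.Quotient.mk_eq_zero]
  have hpow : ∀ n, ∀ v ∈ M, (S ^ n) v ∈ M := fun n => by
    induction n with
    | zero => exact fun v hv => hv
    | succ n ih => exact fun v hv => ih _ (hM _ hv)
  -- For every `c` the orbit sum of `c • v` is fixed, hence zero modulo the span of the fixed
  -- vectors. Independence of the powers of `τ` then kills each term, in particular the class of
  -- `v`.
  refine eq_zero_of_sum_pow_smul hK h.ne_one
    (p := fun i : Fin 5 => Submodule.Quotient.mk ((S ^ (i : ℕ)) v)) (fun c => ?_) 0
  simp only [← Submodule.Quotient.mk_smul, ← h.pow_smul]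
  refine (map_sum (Submodule.mkQ _) (fun i : Fin 5 => (S ^ (i : ℕ)) (c • v)) _).symm.trans ?_
  rw [Submodule.mkQ_apply, Submodule.Quotient.mk_eq_zero]
  refine Submodule.subset_span ⟨Submodule.sum_mem _ fun i _ => hpow _ _ (M.smul_mem c hv), ?_⟩
  simp only [Fin.sum_univ_five, map_add]
  have h5 := h.apply_five
  simp [pow_succ, h5]
  abel

theorem exists_fixed_pair [Finite F₀] (hK : finrank F₀ K = 5) (h : IsTwist τ S σ)
    {M : Submodule K V} (hM : ∀ v ∈ M, S v ∈ M) (h2 : 2 ≤ finrank K M) :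
    ∃ x ∈ M, ∃ y ∈ M, S x = x ∧ S y = y ∧ x ≠ 0 ∧ ∀ c : K, y ≠ c • x := by
  have hle := h.le_span_fixed hK hM
  have h1 : ∃ x ∈ M, S x = x ∧ x ≠ 0 := by
    by_contra! hx
    have : M ≤ ⊥ := hle.trans (Submodule.span_le.2 fun x hx' => hx x hx'.1 hx'.2)
    rw [le_bot_iff.1 this, finrank_bot] at h2
    omega
  obtain ⟨x, hxM, hx, hx0⟩ := h1
  refine ⟨x, hxM, ?_⟩
  by_contra! hy
  have : M ≤ Submodule.span K {x} := hle.trans (Submodule.span_le.2 fun y hy' => by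
    obtain ⟨c, hc⟩ := hy y hy'.1 hx hy'.2 hx0
    exact Submodule.mem_span_singleton.2 ⟨c, hc.symm⟩)
  have := Submodule.finrank_mono this
  rw [finrank_span_singleton hx0] at this
  omega

end IsTwist

namespace IsScatteredVertex

theorem pow (h : IsTwist τ S σ) (hΓ : IsScatteredVertex K S Γ) {k : ℕ} (h0 : 0 < k)
    (h5 : k < 5) : IsScatteredVertex K (S ^ k) Γ where
  finrank_eq := hΓ.finrank_eq
  eq_zero := by simpa only [h.pow_apply_eq_self_iff h0 h5] using hΓ.eq_zero
  scattered := by simpa only [h.pow_apply_eq_self_iff h0 h5] using hΓ.scattered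

theorem not_le [Finite F₀] (hK : finrank F₀ K = 5) (h : IsTwist τ S σ)
    (hΓ : IsScatteredVertex K S Γ) {M : Submodule K V} (hM : ∀ v ∈ M, S v ∈ M) (hM0 : M ≠ ⊥) :
    ¬ M ≤ Γ := fun hle => hM0 <| by
  rw [eq_bot_iff]
  exact (h.le_span_fixed hK hM).trans
    (Submodule.span_le.2 fun x hx => hΓ.eq_zero x (hle hx.1) hx.2)

/-- `M` contains two independent fixed vectors `x` and `y`, and `x ∉ Γ`. If `M ⊓ Γ` had codimension
at most one in `M`, then `y` would be congruent to a multiple of `x` modulo `Γ`, against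
scatteredness. -/
theorem finrank_inf_add_two_le [Finite F₀] [FiniteDimensional K V] [IsScalarTower F₀ K V]
    (hK : finrank F₀ K = 5)
    (h : IsTwist τ S σ) (hΓ : IsScatteredVertex K S Γ) {M : Submodule K V}
    (hM : ∀ v ∈ M, S v ∈ M) (h2 : 2 ≤ finrank K M) :
    finrank K ↥(M ⊓ Γ) + 2 ≤ finrank K M := by
  by_contra! hlt
  obtain ⟨x, hxM, y, hyM, hx, hy, hx0, hxy⟩ := h.exists_fixed_pair hK hM h2
  have hxΓ : x ∉ Γ := fun hmem => hx0 (hΓ.eq_zero x hmem hx)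
  have hd : Submodule.span K {x} ⊓ (M ⊓ Γ) = ⊥ := by
    rw [eq_bot_iff]
    intro v hv
    obtain ⟨c, rfl⟩ := Submodule.mem_span_singleton.1 hv.1
    by_cases hc : c = 0
    · simp [hc]
    · exact absurd ((Γ.smul_mem_iff hc).1 hv.2.2) hxΓ
  have hsum := Submodule.finrank_sup_add_finrank_inf_eq (Submodule.span K {x}) (M ⊓ Γ)
  rw [hd, finrank_bot, finrank_span_singleton hx0] at hsum
  have hle : Submodule.span K {x} ⊔ (M ⊓ Γ) ≤ M :=
    sup_le ((Submodule.span_singleton_le_iff_mem _ _).2 hxM) inf_le_left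
  have heq := Submodule.eq_of_le_of_finrank_le hle (by omega)
  rw [← heq, Submodule.mem_sup] at hyM
  obtain ⟨u, hu, z, hz, rfl⟩ := hyM
  obtain ⟨c, rfl⟩ := Submodule.mem_span_singleton.1 hu
  obtain ⟨b, hb⟩ := hΓ.scattered x _ hx hy hx0 c (by simpa using hz.2)
  exact hxy (algebraMap F₀ K b) (by rw [hb, algebraMap_smul])

end IsScatteredVertex

end Twist

/-! ### Linear independence of orbits meeting the vertex. -/

section Orbits

variable {F₀ K V : Type*} [Field F₀] [Field K] [AddCommGroup V] [Module K V] [Module F₀ V]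

theorem linearIndependent_orbit_succ {S : V ≃ₗ[F₀] V} {a : V} {n : ℕ}
    (h : LinearIndependent K fun i : Fin n => (S ^ (i : ℕ)) a)
    (hn : (S ^ n) a ∉ orbitSpan K S a n) :
    LinearIndependent K fun i : Fin (n + 1) => (S ^ (i : ℕ)) a := by
  rw [linearIndependent_finSucc']
  exact ⟨h, hn⟩

theorem finrank_orbitSpan {S : V ≃ₗ[F₀] V} {a : V} {n : ℕ}
    (h : LinearIndependent K fun i : Fin n => (S ^ (i : ℕ)) a) :
    finrank K (orbitSpan K S a n) = n := by
  rw [orbitSpan, finrank_span_eq_card h, Fintype.card_fin]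

variable [Algebra F₀ K] {τ : K ≃ₐ[F₀] K} {S : V ≃ₗ[F₀] V}
  {σ : Submodule K V ≃o Submodule K V} {Γ : Submodule K V}

theorem IsTwist.apply_mem_orbitSpan (h : IsTwist τ S σ) {a : V} {n : ℕ}
    (hn : (S ^ n) a ∈ orbitSpan K S a n) {v : V} (hv : v ∈ orbitSpan K S a n) :
    S v ∈ orbitSpan K S a n := by
  induction hv using Submodule.span_induction with
  | mem x hx =>
    obtain ⟨i, rfl⟩ := hx
    change S ((S ^ (i : ℕ)) a) ∈ _
    rw [← LinearEquiv.mul_apply, ← pow_succ']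
    rcases (Nat.succ_le_of_lt i.2).lt_or_eq with hi | hi
    · exact pow_mem_orbitSpan a hi
    · rwa [← Nat.succ_eq_add_one, hi]
  | zero => simp
  | add x y _ _ hx hy => rw [map_add]; exact add_mem hx hy
  | smul c x _ hx => rw [h.map_smul]; exact Submodule.smul_mem _ _ hx

namespace IsScatteredVertex

/-- If no three consecutive vectors of an orbit are in `Γ`, then `Γ` and its image under the
collineation meet in a point. -/
theorem finrank_inf_apply [FiniteDimensional K V] (hV : finrank K V = 5) (h : IsTwist τ S σ)
    (hΓ : IsScatteredVertex K S Γ)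
    (hno : ∀ a, a ∈ Γ → S a ∈ Γ → S (S a) ∈ Γ → a = 0) : finrank K ↥(Γ ⊓ σ Γ) = 1 := by
  have hσΓ : finrank K (σ Γ) = 3 := by rw [h.finrank_apply, hΓ.finrank_eq]
  have h1 := Submodule.finrank_sup_add_finrank_inf_eq Γ (σ Γ)
  have h2 := Submodule.finrank_le (Γ ⊔ σ Γ)
  rw [hΓ.finrank_eq, hσΓ] at h1
  rw [hV] at h2
  by_contra hne
  -- If the intersection had rank at least two, it and its image would both lie in the plane `σ Γ`
  -- and would meet. A common vector has the form `S (S a)` with `a`, `S a`, `S (S a)` in `Γ`.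
  have h3 := Submodule.finrank_sup_add_finrank_inf_eq (Γ ⊓ σ Γ) (σ (Γ ⊓ σ Γ))
  have h4 : finrank K ↥(Γ ⊓ σ Γ ⊔ σ (Γ ⊓ σ Γ)) ≤ finrank K (σ Γ) :=
    Submodule.finrank_mono (sup_le inf_le_right (σ.monotone inf_le_left))
  rw [h.finrank_apply] at h3
  have h5 : (Γ ⊓ σ Γ) ⊓ σ (Γ ⊓ σ Γ) ≠ ⊥ := fun h0 => by
    rw [h0, finrank_bot] at h3
    omega
  obtain ⟨p, hp, hp0⟩ := Submodule.exists_mem_ne_zero_of_ne_bot h5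
  obtain ⟨p, rfl⟩ := S.surjective p
  obtain ⟨a, rfl⟩ := S.surjective p
  have hp2 := (h.mem_iff _ _).1 hp.2
  exact hp0 (by rw [hno a ((h.mem_iff _ _).1 hp2.2) hp2.1 hp.1.1, map_zero, map_zero])

variable [Finite F₀] [FiniteDimensional K V] [IsScalarTower F₀ K V]

/-- At a first dependence the span of the preceding vectors is invariant. In rank one or two it
would lie in `Γ`, which contains no nonzero invariant subspace. In rank three it would meet `Γ` in
rank at least two, and `finrank_inf_add_two_le` allows only one. -/
theorem linearIndependent_orbit_four (hK : finrank F₀ K = 5) (h : IsTwist τ S σ)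
    (hΓ : IsScatteredVertex K S Γ) {a : V} (ha0 : a ≠ 0) (ha : a ∈ Γ) (ha1 : S a ∈ Γ) :
    LinearIndependent K fun i : Fin 4 => (S ^ (i : ℕ)) a := by
  have hle : ∀ n, n ≤ 2 → orbitSpan K S a n ≤ Γ := fun n hn => orbitSpan_le fun i hi => by
    obtain rfl | rfl : i = 0 ∨ i = 1 := by omega
    exacts [ha, ha1]
  have hne : ∀ n, 0 < n → orbitSpan K S a n ≠ ⊥ := fun n hn h0 => ha0 <| by
    have := pow_mem_orbitSpan (K := K) (S := S) a hn
    rwa [h0, Submodule.mem_bot, pow_zero] at this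
  have h0 : LinearIndependent K fun i : Fin 0 => (S ^ (i : ℕ)) a := linearIndependent_empty_type
  have h1 := linearIndependent_orbit_succ h0 fun hmem => ha0 <| by
    simpa [orbitSpan] using hmem
  have h2 := linearIndependent_orbit_succ h1 fun hmem =>
    hΓ.not_le hK h (fun v => h.apply_mem_orbitSpan hmem) (hne 1 one_pos) (hle 1 (by omega))
  have h3 := linearIndependent_orbit_succ h2 fun hmem =>
    hΓ.not_le hK h (fun v => h.apply_mem_orbitSpan hmem) (hne 2 two_pos) (hle 2 le_rfl)
  refine linearIndependent_orbit_succ h3 fun hmem => ?_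
  have := hΓ.finrank_inf_add_two_le hK h (fun v => h.apply_mem_orbitSpan hmem)
    (by rw [finrank_orbitSpan h3]; omega)
  rw [finrank_orbitSpan h3] at this
  have hsub : orbitSpan K S a 2 ≤ orbitSpan K S a 3 ⊓ Γ :=
    le_inf (orbitSpan_le fun i hi => pow_mem_orbitSpan a (by omega)) (hle 2 le_rfl)
  have := Submodule.finrank_mono hsub
  rw [finrank_orbitSpan h2] at this
  omega

/-- Otherwise the first four vectors span an invariant hyperplane containing `Γ`, which is too large
by `finrank_inf_add_two_le`. -/
theorem linearIndependent_orbit_five (hK : finrank F₀ K = 5) (h : IsTwist τ S σ)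
    (hΓ : IsScatteredVertex K S Γ) {a : V} (ha0 : a ≠ 0) (ha : a ∈ Γ) (ha1 : S a ∈ Γ)
    (hle : (S ^ 4) a ∈ orbitSpan K S a 4 → Γ ≤ orbitSpan K S a 4) :
    LinearIndependent K fun i : Fin 5 => (S ^ (i : ℕ)) a := by
  have h4 := hΓ.linearIndependent_orbit_four hK h ha0 ha ha1
  refine linearIndependent_orbit_succ h4 fun hmem => ?_
  have := hΓ.finrank_inf_add_two_le hK h (fun v => h.apply_mem_orbitSpan hmem)
    (by rw [finrank_orbitSpan h4]; omega)
  rw [finrank_orbitSpan h4, inf_eq_right.2 (hle hmem), hΓ.finrank_eq] at this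
  omega

end IsScatteredVertex

end Orbits

/-! ### The points A, B, E and the special position of the vertex. -/

section Points

theorem Submodule.finrank_sup_eq_two {K V : Type*} [Field K] [AddCommGroup V] [Module K V]
    {v w : V} (hv : v ≠ 0) (hw : w ∉ Submodule.span K {v}) :
    finrank K ↥(Submodule.span K {v} ⊔ Submodule.span K {w}) = 2 := by
  have hw0 : w ≠ 0 := fun h => hw (h ▸ zero_mem _)
  have h := Submodule.finrank_sup_add_finrank_inf_eq (Submodule.span K {v}) (Submodule.span K {w})
  have hd : Submodule.span K {v} ⊓ Submodule.span K {w} = ⊥ :=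
    ((Submodule.disjoint_span_singleton' hw0).2 hw).eq_bot
  rw [hd, finrank_bot, finrank_span_singleton hv, finrank_span_singleton hw0] at h
  omega

/-- Distinct lines of a plane meet in a point. -/
theorem Submodule.finrank_inf_eq_one {K V : Type*} [Field K] [AddCommGroup V] [Module K V]
    [FiniteDimensional K V] {P Q M : Submodule K V} (hP : finrank K P = 2) (hQ : finrank K Q = 2)
    (hM : finrank K M = 3) (hPM : P ≤ M) (hQM : Q ≤ M) (hne : P ≠ Q) :
    finrank K ↥(P ⊓ Q) = 1 := by
  have h := Submodule.finrank_sup_add_finrank_inf_eq P Q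
  have h1 := Submodule.finrank_mono (sup_le hPM hQM)
  have h2 : finrank K ↥(P ⊓ Q) < finrank K P := by
    refine Submodule.finrank_lt_finrank_of_lt (lt_of_le_of_ne inf_le_left fun heq => hne ?_)
    exact Submodule.eq_of_le_of_finrank_le (inf_eq_left.1 heq) (by omega)
  omega

theorem Submodule.exists_smul_add_of_finrank_eq_three {K V : Type*} [Field K] [AddCommGroup V]
    [Module K V] [FiniteDimensional K V] {M : Submodule K V} (hM : finrank K M = 3) {u v w : V}
    (hu : u ∈ M) (hv : v ∈ M) (hw : w ∈ M) (h : LinearIndependent K ![u, v, w]) {x : V}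
    (hx : x ∈ M) : ∃ a b c : K, a • u + b • v + c • w = x := by
  have hle : Submodule.span K (Set.range ![u, v, w]) ≤ M := by
    rw [Submodule.span_le]
    rintro _ ⟨i, rfl⟩
    fin_cases i
    exacts [hu, hv, hw]
  have heq := Submodule.eq_of_le_of_finrank_le hle
    (by rw [hM, finrank_span_eq_card h, Fintype.card_fin])
  rw [← heq, Submodule.mem_span_range_iff_exists_fun] at hx
  obtain ⟨c, rfl⟩ := hx
  exact ⟨c 0, c 1, c 2, by simp [Fin.sum_univ_three]⟩

theorem Submodule.eq_span_singleton_of_mem {K V : Type*} [Field K] [AddCommGroup V] [Module K V]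
    {M : Submodule K V} (h : finrank K M = 1) {v : V} (hv : v ∈ M) (hv0 : v ≠ 0) :
    M = Submodule.span K {v} := by
  have : FiniteDimensional K M := FiniteDimensional.of_finrank_pos (by omega)
  refine (Submodule.eq_of_le_of_finrank_le ?_ ?_).symm
  · exact (Submodule.span_singleton_le_iff_mem _ _).2 hv
  · rw [h, finrank_span_singleton hv0]

variable {F₀ K V : Type*} [Field F₀] [Field K] [AddCommGroup V] [Module K V] [Module F₀ V]

/-- The plane `Γ` is spanned by `a`, `S a` and a point on the line through `S² a` and `S⁴ a`. -/
def IsLPVertex (K : Type*) {V : Type*} [Field K] [AddCommGroup V] [Module K V] [Module F₀ V]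
    (S : V ≃ₗ[F₀] V) (Γ : Submodule K V) : Prop :=
  ∃ (a : V) (α β : K), a ≠ 0 ∧ α ≠ 0 ∧ β ≠ 0 ∧ a ∈ Γ ∧ S a ∈ Γ ∧
    α • S (S a) + β • S (S (S (S a))) ∈ Γ

theorem eq_zero_of_orbit_five {S : V ≃ₗ[F₀] V} {a : V}
    (h : LinearIndependent K fun i : Fin 5 => (S ^ (i : ℕ)) a) {c₀ c₁ c₂ c₃ c₄ : K}
    (hc : c₀ • a + c₁ • S a + c₂ • S (S a) + c₃ • S (S (S a)) + c₄ • S (S (S (S a))) = 0) :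
    c₀ = 0 ∧ c₁ = 0 ∧ c₂ = 0 ∧ c₃ = 0 ∧ c₄ = 0 := by
  rw [Fintype.linearIndependent_iff] at h
  have := h ![c₀, c₁, c₂, c₃, c₄] (by simpa [Fin.sum_univ_five, pow_succ] using hc)
  exact ⟨this 0, this 1, this 2, this 3, this 4⟩

variable [Algebra F₀ K] {τ : K ≃ₐ[F₀] K} {S : V ≃ₗ[F₀] V}
  {σ : Submodule K V ≃o Submodule K V} {Γ : Submodule K V}

namespace IsTwist

theorem pow_five_apply (h : IsTwist τ S σ) (M : Submodule K V) : σ (σ (σ (σ (σ M)))) = M := by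
  have := congrArg (fun s : Submodule K V ≃o Submodule K V => s M) h.collineation_pow_five
  simpa [pow_succ] using this

theorem mem_pow_four_iff (h : IsTwist τ S σ) (v : V) : v ∈ (σ ^ 4) Γ ↔ S v ∈ Γ := by
  rw [← h.mem_iff]
  simp [pow_succ, h.pow_five_apply]

theorem mem_pow_three_iff (h : IsTwist τ S σ) (v : V) : v ∈ (σ ^ 3) Γ ↔ S (S v) ∈ Γ := by
  rw [← h.mem_iff, ← h.mem_iff]
  simp [pow_succ, h.pow_five_apply]

/-- Either forbidden proportionality would put three consecutive orbit vectors in `Γ`: those of `a`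
if `b` is a multiple of `a`, those of `b` if `S (S b)` is a multiple of `S a`. -/
theorem exists_vertex_vectors (h : IsTwist τ S σ)
    (hno : ∀ a, a ∈ Γ → S a ∈ Γ → S (S a) ∈ Γ → a = 0)
    {A B : Submodule K V} (hA : A = Γ ⊓ (σ ^ 4) Γ) (hB : B = Γ ⊓ (σ ^ 3) Γ)
    (hA1 : finrank K A = 1) (hB1 : finrank K B = 1) {a : V} (haA : a ∈ A) (ha0 : a ≠ 0) :
    a ∈ Γ ∧ S a ∈ Γ ∧ A = Submodule.span K {a} ∧ ∃ b, b ≠ 0 ∧ b ∈ Γ ∧ S (S b) ∈ Γ ∧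
      B = Submodule.span K {b} ∧ b ∉ Submodule.span K {a} ∧
      S (S b) ∉ Submodule.span K {S a} := by
  obtain ⟨b, hbB, hb0⟩ := Submodule.exists_mem_ne_zero_of_ne_bot (p := B)
    (fun h0 => by rw [h0, finrank_bot] at hB1; omega)
  have hAa := Submodule.eq_span_singleton_of_mem hA1 haA ha0
  have hBb := Submodule.eq_span_singleton_of_mem hB1 hbB hb0
  rw [hA, Submodule.mem_inf, h.mem_pow_four_iff] at haA
  rw [hB, Submodule.mem_inf, h.mem_pow_three_iff] at hbB
  refine ⟨haA.1, haA.2, hAa, b, hb0, hbB.1, hbB.2, hBb, fun hmem => ?_, fun hmem => ?_⟩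
  · obtain ⟨c, rfl⟩ := Submodule.mem_span_singleton.1 hmem
    have hc : c ≠ 0 := fun h0 => hb0 (by rw [h0, zero_smul])
    have h2 := hbB.2
    rw [h.map_smul, h.map_smul, Γ.smul_mem_iff (by simpa using hc)] at h2
    exact ha0 (hno a haA.1 haA.2 h2)
  · obtain ⟨c, hc⟩ := Submodule.mem_span_singleton.1 hmem
    obtain ⟨c, rfl⟩ := τ.surjective c
    rw [← h.map_smul] at hc
    have hc' := S.injective hc
    exact hb0 (hno b hbB.1 (hc' ▸ Γ.smul_mem c haA.1) hbB.2)

end IsTwist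

namespace IsScatteredVertex

variable [Finite F₀] [FiniteDimensional K V] [IsScalarTower F₀ K V]

/-- Applying `S` moves the three vectors into the span of the first four orbit vectors, which are
independent. -/
theorem linearIndependent_vertex (hK : finrank F₀ K = 5) (h : IsTwist τ S σ)
    (hΓ : IsScatteredVertex K S Γ) {a : V} {α β : K} (ha0 : a ≠ 0) (hα : α ≠ 0) (ha : a ∈ Γ)
    (ha1 : S a ∈ Γ) : LinearIndependent K ![a, S a, α • S (S a) + β • S (S (S (S a)))] := by
  have hli := hΓ.linearIndependent_orbit_four hK h ha0 ha ha1
  rw [Fintype.linearIndependent_iff] at hli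
  rw [Fintype.linearIndependent_iff]
  intro g hg
  have h5 := h.apply_five
  have hS := congrArg S hg
  simp only [Fin.sum_univ_three, Matrix.cons_val_zero, Matrix.cons_val_one, Matrix.cons_val,
    map_add, h.map_smul, map_zero, smul_add, h5] at hS
  have := hli ![τ (g 2) * τ β, τ (g 0), τ (g 1), τ (g 2) * τ α] (by
    rw [← hS]
    simp [Fin.sum_univ_four, pow_succ]
    module)
  have h0 : g 0 = 0 := by simpa using this 1
  have h1 : g 1 = 0 := by simpa using this 2
  have h2 : g 2 = 0 := by simpa [hα] using this 3
  intro i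
  fin_cases i
  exacts [h0, h1, h2]

theorem linearIndependent_orbit_of_vertex (hK : finrank F₀ K = 5) (h : IsTwist τ S σ)
    (hΓ : IsScatteredVertex K S Γ) {a : V} {α β : K} (ha0 : a ≠ 0) (hα : α ≠ 0) (ha : a ∈ Γ)
    (ha1 : S a ∈ Γ) (hQ : α • S (S a) + β • S (S (S (S a))) ∈ Γ) :
    LinearIndependent K fun i : Fin 5 => (S ^ (i : ℕ)) a := by
  refine hΓ.linearIndependent_orbit_five hK h ha0 ha ha1 fun hmem x hx => ?_
  obtain ⟨c, d, e, rfl⟩ := Submodule.exists_smul_add_of_finrank_eq_three hΓ.finrank_eq ha ha1 hQ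
    (hΓ.linearIndependent_vertex hK h ha0 hα ha ha1) hx
  have h0 := pow_mem_orbitSpan (K := K) (S := S) a (show 0 < 4 by omega)
  have h1 := pow_mem_orbitSpan (K := K) (S := S) a (show 1 < 4 by omega)
  have h2 := pow_mem_orbitSpan (K := K) (S := S) a (show 2 < 4 by omega)
  simp only [pow_succ, pow_zero, one_mul, LinearEquiv.mul_apply, LinearEquiv.coe_one, id]
    at h0 h1 h2 hmem
  exact add_mem (add_mem (Submodule.smul_mem _ _ h0) (Submodule.smul_mem _ _ h1))
    (Submodule.smul_mem _ _ (add_mem (Submodule.smul_mem _ _ h2) (Submodule.smul_mem _ _ hmem)))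

/-- Both lines lie in the plane `Γ`, so it suffices that they differ. If they coincide, both are
`⟨a, S a⟩`. Then `b` is a combination of `a, S a`, so that `S² b` is one of `S² a, S³ a` as well as
of `a, S a`, and independence gives `b = 0`. -/
theorem finrank_diagonal_point (hK : finrank F₀ K = 5) (h : IsTwist τ S σ)
    (hΓ : IsScatteredVertex K S Γ) (hno : ∀ a, a ∈ Γ → S a ∈ Γ → S (S a) ∈ Γ → a = 0)
    {A B : Submodule K V} (hA : A = Γ ⊓ (σ ^ 4) Γ) (hB : B = Γ ⊓ (σ ^ 3) Γ)
    (hA1 : finrank K A = 1) (hB1 : finrank K B = 1) :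
    finrank K ↥((A ⊔ B) ⊓ (σ A ⊔ (σ ^ 2) B)) = 1 := by
  obtain ⟨a, haA, ha0⟩ := Submodule.exists_mem_ne_zero_of_ne_bot (p := A)
    (fun h0 => by rw [h0, finrank_bot] at hA1; omega)
  obtain ⟨ha, ha1, hAa, b, hb0, hb, hb2, hBb, hab, hab'⟩ :=
    h.exists_vertex_vectors hno hA hB hA1 hB1 haA ha0
  have hσA : σ A = Submodule.span K {S a} := by rw [hAa, h.apply_span_singleton]
  have hσB : (σ ^ 2) B = Submodule.span K {S (S b)} := by
    rw [hBb, pow_two, RelIso.mul_apply, h.apply_span_singleton, h.apply_span_singleton]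
  have hli := hΓ.linearIndependent_orbit_four hK h ha0 ha ha1
  have hli' : ∀ c₀ c₁ c₂ c₃ : K, c₀ • a + c₁ • S a + c₂ • S (S a) + c₃ • S (S (S a)) = 0 →
      c₀ = 0 ∧ c₁ = 0 ∧ c₂ = 0 ∧ c₃ = 0 := fun c₀ c₁ c₂ c₃ hc => by
    rw [Fintype.linearIndependent_iff] at hli
    have := hli ![c₀, c₁, c₂, c₃] (by simpa [Fin.sum_univ_four, pow_succ] using hc)
    exact ⟨this 0, this 1, this 2, this 3⟩
  have hsa0 : S a ≠ 0 := by simpa using ha0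
  rw [hσA, hσB, hAa, hBb]
  refine Submodule.finrank_inf_eq_one (Submodule.finrank_sup_eq_two ha0 hab)
    (Submodule.finrank_sup_eq_two hsa0 hab') hΓ.finrank_eq ?_ ?_ fun heq => ?_
  · simp only [sup_le_iff, Submodule.span_singleton_le_iff_mem]
    exact ⟨ha, hb⟩
  · simp only [sup_le_iff, Submodule.span_singleton_le_iff_mem]
    exact ⟨ha1, hb2⟩
  · have haa : S a ∉ Submodule.span K {a} := fun hmem => by
      obtain ⟨c, hc⟩ := Submodule.mem_span_singleton.1 hmem
      have := hli' c (-1) 0 0 (by simp [hc])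
      simpa using this.2.1
    have hle : Submodule.span K {a} ⊔ Submodule.span K {S a} ≤
        Submodule.span K {a} ⊔ Submodule.span K {b} :=
      sup_le le_sup_left (heq ▸ le_sup_left)
    have heq' := Submodule.eq_of_le_of_finrank_le hle (by
      rw [Submodule.finrank_sup_eq_two ha0 hab, Submodule.finrank_sup_eq_two ha0 haa])
    have h1 : b ∈ Submodule.span K {a} ⊔ Submodule.span K {S a} :=
      heq' ▸ Submodule.mem_sup_right (Submodule.mem_span_singleton_self b)
    have h2 : S (S b) ∈ Submodule.span K {a} ⊔ Submodule.span K {S a} := by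
      rw [heq', heq]
      exact Submodule.mem_sup_right (Submodule.mem_span_singleton_self _)
    rw [← Submodule.span_insert, Submodule.mem_span_pair] at h1 h2
    obtain ⟨c, d, rfl⟩ := h1
    obtain ⟨c', d', h2⟩ := h2
    simp only [map_add, h.map_smul] at h2
    have := hli' c' d' (-τ (τ c)) (-τ (τ d)) (by
      rw [h2]; module)
    have hc : c = 0 := by simpa using this.2.2.1
    have hd : d = 0 := by simpa using this.2.2.2
    exact hb0 (by simp [hc, hd])

/-- From left to right, a vector of the diagonal point is `α S² a + β S⁴ a`, and both coefficients
are nonzero because `Γ` contains no three consecutive orbit vectors. From right to left, this vector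
is shown to lie on both lines. -/
theorem diagonal_point_le_iff (hK : finrank F₀ K = 5) (h : IsTwist τ S σ)
    (hΓ : IsScatteredVertex K S Γ) (hno : ∀ a, a ∈ Γ → S a ∈ Γ → S (S a) ∈ Γ → a = 0)
    {A B : Submodule K V} (hA : A = Γ ⊓ (σ ^ 4) Γ) (hB : B = Γ ⊓ (σ ^ 3) Γ)
    (hA1 : finrank K A = 1) (hB1 : finrank K B = 1) :
    (A ⊔ B) ⊓ (σ A ⊔ (σ ^ 2) B) ≤ (σ ^ 2) A ⊔ (σ ^ 4) A ↔ IsLPVertex K S Γ := by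
  have hE := hΓ.finrank_diagonal_point hK h hno hA hB hA1 hB1
  have h5 := h.apply_five
  have hσ : ∀ a, (σ ^ 2) (Submodule.span K {a}) ⊔ (σ ^ 4) (Submodule.span K {a}) =
      Submodule.span K {S (S a), S (S (S (S a)))} := fun a => by
    simp [pow_succ, h.apply_span_singleton, Submodule.span_insert]
  constructor
  · intro hle
    obtain ⟨a, haA, ha0⟩ := Submodule.exists_mem_ne_zero_of_ne_bot (p := A)
      (fun h0 => by rw [h0, finrank_bot] at hA1; omega)
    obtain ⟨ha, ha1, hAa, b, hb0, hb, hb2, hBb, hab, hab'⟩ :=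
      h.exists_vertex_vectors hno hA hB hA1 hB1 haA ha0
    obtain ⟨e, he, he0⟩ := Submodule.exists_mem_ne_zero_of_ne_bot
      (p := (A ⊔ B) ⊓ (σ A ⊔ (σ ^ 2) B)) (fun h0 => by rw [h0, finrank_bot] at hE; omega)
    have heΓ : e ∈ Γ := by
      have : A ⊔ B ≤ Γ := sup_le (hA ▸ inf_le_left) (hB ▸ inf_le_left)
      exact this he.1
    have he' := hle he
    rw [hAa, hσ, Submodule.mem_span_pair] at he'
    obtain ⟨α, β, rfl⟩ := he'
    refine ⟨a, α, β, ha0, ?_, ?_, ha, ha1, heΓ⟩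
    · rintro rfl
      have hβ : β ≠ 0 := by rintro rfl; simp at he0
      rw [zero_smul, zero_add, Γ.smul_mem_iff hβ] at heΓ
      have := hno _ heΓ (by rwa [h5]) (by rwa [h5])
      exact ha0 (by simpa using this)
    · rintro rfl
      have hα : α ≠ 0 := by rintro rfl; simp at he0
      rw [zero_smul, add_zero, Γ.smul_mem_iff hα] at heΓ
      exact ha0 (hno a ha ha1 heΓ)
  · rintro ⟨a, α, β, ha0, hα, hβ, ha, ha1, hQ⟩
    have haA : a ∈ A := by
      rw [hA, Submodule.mem_inf, h.mem_pow_four_iff]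
      exact ⟨ha, ha1⟩
    obtain ⟨-, -, hAa, b, hb0, hb, hb2, hBb, hab, hab'⟩ :=
      h.exists_vertex_vectors hno hA hB hA1 hB1 haA ha0
    have hli3 := hΓ.linearIndependent_vertex hK h (β := β) ha0 hα ha ha1
    have hli5 := hΓ.linearIndependent_orbit_of_vertex hK h ha0 hα ha ha1 hQ
    obtain ⟨x, y, z, hxyz⟩ :=
      Submodule.exists_smul_add_of_finrank_eq_three hΓ.finrank_eq ha ha1 hQ hli3 hb
    obtain ⟨u, v, w, huvw⟩ :=
      Submodule.exists_smul_add_of_finrank_eq_three hΓ.finrank_eq ha ha1 hQ hli3 hb2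
    have hS := congrArg (fun v => S (S v)) hxyz
    simp only [map_add, h.map_smul, smul_add, h5] at hS
    -- Two expansions of `S² b` in the orbit basis are compared: one has no `S³ a` term and the
    -- other no `a` term. Hence `y = u = 0`, so `b` lies in `⟨a, Q⟩` and `S² b` in `⟨S a, Q⟩`, where
    -- `Q = α S² a + β S⁴ a`.
    obtain ⟨hu, -, -, hy, -⟩ := eq_zero_of_orbit_five hli5 (c₀ := u)
      (c₁ := v - τ (τ z) * τ (τ β)) (c₂ := w * α - τ (τ x)) (c₃ := -τ (τ y))
      (c₄ := w * β - τ (τ z) * τ (τ α)) (by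
        have := huvw.trans hS.symm
        rw [← sub_eq_zero] at this
        rw [← this]
        module)
    have hy : y = 0 := by simpa using hy
    rw [hy, zero_smul, add_zero] at hxyz
    rw [hu, zero_smul, zero_add] at huvw
    have hz : z ≠ 0 := by
      rintro rfl
      exact hab (Submodule.mem_span_singleton.2 ⟨x, by rw [← hxyz]; module⟩)
    have hw : w ≠ 0 := by
      rintro rfl
      exact hab' (Submodule.mem_span_singleton.2 ⟨v, by rw [← huvw]; module⟩)
    have hQ0 : α • S (S a) + β • S (S (S (S a))) ≠ 0 := hli3.ne_zero 2
    have hQE : α • S (S a) + β • S (S (S (S a))) ∈ (A ⊔ B) ⊓ (σ A ⊔ (σ ^ 2) B) := by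
      have hσB : (σ ^ 2) B = Submodule.span K {S (S b)} := by
        rw [hBb, pow_two, RelIso.mul_apply, h.apply_span_singleton, h.apply_span_singleton]
      rw [hσB, hAa, hBb, h.apply_span_singleton, ← Submodule.span_insert, ← Submodule.span_insert,
        Submodule.mem_inf, Submodule.mem_span_pair, Submodule.mem_span_pair]
      refine ⟨⟨-z⁻¹ * x, z⁻¹, ?_⟩, ⟨-w⁻¹ * v, w⁻¹, ?_⟩⟩
      · rw [← hxyz, smul_add, inv_smul_smul₀ hz]; module
      · rw [← huvw, smul_add, inv_smul_smul₀ hw]; module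
    rw [Submodule.eq_span_singleton_of_mem hE hQE hQ0, Submodule.span_singleton_le_iff_mem, hAa, hσ,
      Submodule.mem_span_pair]
    exact ⟨α, β, rfl⟩

end IsScatteredVertex

end Points

/-! ### From the position of the vertex to the type of the linear set. -/

section Projection

variable {F₀ K V W : Type*} [Field F₀] [Field K] [AddCommGroup V] [Module K V] [Module F₀ V]
  [AddCommGroup W] [Module K W]

/-- The `F₀`-subspace of the vectors fixed by `S`. -/
def fixedVectors (S : V ≃ₗ[F₀] V) : Submodule F₀ V :=
  LinearMap.eqLocus S.toLinearMap LinearMap.id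

theorem mem_fixedVectors {S : V ≃ₗ[F₀] V} {v : V} : v ∈ fixedVectors S ↔ S v = v := Iff.rfl

/-- The points `⟨π v⟩` of the nonzero vectors `v` fixed by `S`. -/
def projectedFixedPoints (S : V ≃ₗ[F₀] V) (π : V →ₗ[K] W) : Set (Submodule K W) :=
  {P | ∃ v, v ≠ 0 ∧ S v = v ∧ P = Submodule.span K {π v}}

theorem coprime_five {s : ℕ} (h0 : 0 < s) (h5 : s < 5) : s.Coprime 5 := by
  interval_cases s <;> decide

theorem isProjectivelyEquivalent_graphSet {p q : W} (hW : finrank K W = 2)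
    (h : ∀ u w : K, u • p + w • q = 0 → u = 0 ∧ w = 0) (f : K → K) :
    IsProjectivelyEquivalent {P | ∃ y : K, y ≠ 0 ∧ P = Submodule.span K {y • p + f y • q}}
      (graphSet f) := by
  have : FiniteDimensional K W := FiniteDimensional.of_finrank_pos (by omega)
  let e' : K × K →ₗ[K] W :=
    (LinearMap.toSpanSingleton K W p).coprod (LinearMap.toSpanSingleton K W q)
  have he' : ∀ z : K × K, e' z = z.1 • p + z.2 • q := fun z => by simp [e']
  have hinj : Function.Injective e' := by
    rw [injective_iff_map_eq_zero]
    intro z hz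
    rw [he'] at hz
    exact Prod.ext_iff.2 (h _ _ hz)
  let e := LinearEquiv.ofInjectiveOfFinrankEq e' hinj (by simp [hW])
  have he : ∀ z, e z = e' z := fun z => rfl
  refine ⟨e, ?_⟩
  ext P
  constructor
  · rintro ⟨y, hy, rfl⟩
    refine ⟨_, ⟨y, hy, rfl⟩, ?_⟩
    simp [LinearMap.map_span, he, he']
  · rintro ⟨_, ⟨y, hy, rfl⟩, rfl⟩
    refine ⟨y, hy, ?_⟩
    simp [LinearMap.map_span, he, he']

variable [Algebra F₀ K] {τ : K ≃ₐ[F₀] K} {S : V ≃ₗ[F₀] V}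
  {σ : Submodule K V ≃o Submodule K V} {Γ : Submodule K V}

theorem IsTwist.apply_orbit_sum (h : IsTwist τ S σ) (hτ : ∀ x, τ (τ (τ (τ (τ x)))) = x) (a : V)
    (x : K) : S (x • a + τ x • S a + τ (τ x) • S (S a) + τ (τ (τ x)) • S (S (S a)) +
      τ (τ (τ (τ x))) • S (S (S (S a)))) =
      x • a + τ x • S a + τ (τ x) • S (S a) + τ (τ (τ x)) • S (S (S a)) +
      τ (τ (τ (τ x))) • S (S (S (S a))) := by
  simp only [map_add, h.map_smul, hτ, h.apply_five]
  abel

/-- In the orbit basis, `S v = v` says that each coordinate is the `τ`-image of the preceding one.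
-/
theorem IsTwist.exists_eq_orbit_sum [FiniteDimensional K V] (h : IsTwist τ S σ) (hV : finrank K V = 5) {a : V}
    (hli : LinearIndependent K fun i : Fin 5 => (S ^ (i : ℕ)) a) {v : V} (hv : S v = v) :
    ∃ x : K, v = x • a + τ x • S a + τ (τ x) • S (S a) + τ (τ (τ x)) • S (S (S a)) +
      τ (τ (τ (τ x))) • S (S (S (S a))) := by
  have htop := hli.span_eq_top_of_card_eq_finrank' (by rw [hV, Fintype.card_fin])
  have hmem : v ∈ Submodule.span K (Set.range fun i : Fin 5 => (S ^ (i : ℕ)) a) :=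
    htop ▸ Submodule.mem_top
  obtain ⟨c, hc⟩ := Submodule.mem_span_range_iff_exists_fun K |>.1 hmem
  replace hc : v = c 0 • a + c 1 • S a + c 2 • S (S a) + c 3 • S (S (S a)) +
      c 4 • S (S (S (S a))) := by
    rw [← hc]; simp [Fin.sum_univ_five, pow_succ]
  have hS := congrArg S hc
  simp only [map_add, h.map_smul, h.apply_five, hv] at hS
  obtain ⟨-, h1, h2, h3, h4⟩ := eq_zero_of_orbit_five hli (c₀ := c 0 - τ (c 4))
    (c₁ := c 1 - τ (c 0)) (c₂ := c 2 - τ (c 1)) (c₃ := c 3 - τ (c 2)) (c₄ := c 4 - τ (c 3)) (by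
      have := hc.symm.trans hS
      rw [← sub_eq_zero] at this
      rw [← this]
      module)
  refine ⟨c 0, ?_⟩
  rw [← sub_eq_zero.1 h1, ← sub_eq_zero.1 h2, ← sub_eq_zero.1 h3, ← sub_eq_zero.1 h4]
  exact hc

variable [Finite F₀] [FiniteDimensional K V] [IsScalarTower F₀ K V]
  {π : V →ₗ[K] W}

/-- If three consecutive vectors of an orbit are in `Γ`, then the projected points form a set of
pseudoregulus type. -/
theorem IsScatteredVertex.isPseudoregulusType (hK : finrank F₀ K = 5) (hV : finrank K V = 5)
    (hW : finrank K W = 2) (h : IsTwist τ S σ) (hΓ : IsScatteredVertex K S Γ)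
    (hπ : LinearMap.ker π = Γ) {a : V} (ha0 : a ≠ 0) (ha : a ∈ Γ) (ha1 : S a ∈ Γ)
    (ha2 : S (S a) ∈ Γ) : IsPseudoregulusType F₀ K (projectedFixedPoints S π) := by
  have hτ := apply_five hK τ
  have hli3 := hΓ.linearIndependent_vertex hK h (β := 0) ha0 one_ne_zero ha ha1
  have hli5 := hΓ.linearIndependent_orbit_of_vertex hK h (β := 0) ha0 one_ne_zero ha ha1
    (by simpa using ha2)
  simp only [one_smul, zero_smul, add_zero] at hli3
  obtain ⟨s, hs0, hs5, hs, -⟩ := exists_eq_pow_card_pow hK h.ne_one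
  refine ⟨s, by rwa [hK], by rw [hK]; exact coprime_five hs0 hs5, ?_⟩
  -- The projection kills the first three terms of an orbit sum; the remaining coordinates are `y =
  -- τ³ x` and `τ y`.
  have heq : projectedFixedPoints S π = {P | ∃ y : K, y ≠ 0 ∧ P = Submodule.span K
      {y • π (S (S (S a))) + (y ^ Nat.card F₀ ^ s) • π (S (S (S (S a))))}} := by
    have hval : ∀ x : K, π (x • a + τ x • S a + τ (τ x) • S (S a) + τ (τ (τ x)) • S (S (S a)) +
        τ (τ (τ (τ x))) • S (S (S (S a)))) = τ (τ (τ x)) • π (S (S (S a))) +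
        (τ (τ (τ x)) ^ Nat.card F₀ ^ s) • π (S (S (S (S a)))) := fun x => by
      rw [← hπ, LinearMap.mem_ker] at ha ha1 ha2
      simp [ha, ha1, ha2, ← hs]
    ext P
    constructor
    · rintro ⟨v, hv0, hv, rfl⟩
      obtain ⟨x, rfl⟩ := h.exists_eq_orbit_sum hV hli5 hv
      refine ⟨τ (τ (τ x)), fun h0 => hv0 ?_, by rw [hval]⟩
      have : x = 0 := by simpa using h0
      simp [this]
    · rintro ⟨y, hy0, rfl⟩
      refine ⟨_, fun h0 => hy0 ?_, h.apply_orbit_sum hτ a (τ (τ y)), by rw [hval, hτ]⟩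
      have := (eq_zero_of_orbit_five hli5 h0).1
      simpa using this
  rw [heq]
  refine isProjectivelyEquivalent_graphSet hW (fun u w huw => ?_) _
  rw [← map_smul π, ← map_smul π, ← map_add π, ← LinearMap.mem_ker, hπ] at huw
  obtain ⟨c, d, e, hcde⟩ :=
    Submodule.exists_smul_add_of_finrank_eq_three hΓ.finrank_eq ha ha1 ha2 hli3 huw
  obtain ⟨-, -, -, h3, h4⟩ := eq_zero_of_orbit_five hli5 (c₀ := -c) (c₁ := -d) (c₂ := -e)
    (c₃ := u) (c₄ := w) (by
      rw [← sub_eq_zero] at hcde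
      rw [← neg_eq_zero, ← hcde]; module)
  exact ⟨h3, h4⟩

/-- Modulo `Γ` the orbit reduces to the independent vectors `S³ a` and `S² a`, with `S⁴ a ≡ -(α/β)
S² a`. If `y` is the `S³ a`-coordinate of a fixed vector, its `S² a`- and `S⁴ a`-coordinates are
`τ⁻¹ y` and `τ y`. The role of `ρ` is thus played by `τ ^ 4 = τ⁻¹`. -/
theorem IsScatteredVertex.isLPType (hK : finrank F₀ K = 5) (hV : finrank K V = 5)
    (hW : finrank K W = 2) (h : IsTwist τ S σ) (hΓ : IsScatteredVertex K S Γ)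
    (hπ : LinearMap.ker π = Γ) (hLP : IsLPVertex K S Γ) :
    IsLPType F₀ K (projectedFixedPoints S π) := by
  obtain ⟨a, α, β, ha0, hα, hβ, ha, ha1, hQ⟩ := hLP
  have : FiniteDimensional F₀ K := FiniteDimensional.of_finrank_pos (by omega)
  have hτ := apply_five hK τ
  have hli3 := hΓ.linearIndependent_vertex hK h (β := β) ha0 hα ha ha1
  have hli5 := hΓ.linearIndependent_orbit_of_vertex hK h ha0 hα ha ha1 hQ
  have hρ : τ ^ 4 ≠ 1 := pow_ne_one_of_lt hK h.ne_one (by omega) (by omega)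
  have hτ4 : ∀ x, (τ ^ 4) x = τ (τ (τ (τ x))) := fun x => by simp [pow_succ]
  have hρ4 : ∀ x, ((τ ^ 4) ^ 4) x = τ x := fun x => by
    rw [← pow_mul, show 4 * 4 = 5 * 3 + 1 from rfl, pow_succ, pow_mul, pow_five_eq_one hK, one_pow,
      one_mul]
  obtain ⟨s, hs0, hs5, hs, hs'⟩ := exists_eq_pow_card_pow hK hρ
  have hli : ∀ u w : K, u • π (S (S (S a))) + w • π (S (S a)) = 0 → u = 0 ∧ w = 0 :=
      fun u w huw => by
    rw [← map_smul π, ← map_smul π, ← map_add π, ← LinearMap.mem_ker, hπ] at huw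
    obtain ⟨c, d, e, hcde⟩ :=
      Submodule.exists_smul_add_of_finrank_eq_three hΓ.finrank_eq ha ha1 hQ hli3 huw
    obtain ⟨-, -, h2, h3, h4⟩ := eq_zero_of_orbit_five hli5 (c₀ := -c) (c₁ := -d)
      (c₂ := w - e * α) (c₃ := u) (c₄ := - e * β) (by
        rw [← sub_eq_zero] at hcde
        rw [← neg_eq_zero, ← hcde]; module)
    have he : e = 0 := by simpa [hβ] using h4
    exact ⟨h3, by simpa [he] using h2⟩
  have hval : ∀ x : K, π (τ (τ x) • a + τ (τ (τ x)) • S a + τ (τ (τ (τ x))) • S (S a) +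
      x • S (S (S a)) + τ x • S (S (S (S a)))) =
      x • π (S (S (S a))) + ((τ ^ 4) x + -(α / β) * ((τ ^ 4) ^ 4) x) • π (S (S a)) := fun x => by
    rw [hτ4, hρ4]
    rw [← hπ, LinearMap.mem_ker] at ha ha1 hQ
    have h4 : π (S (S (S (S a)))) = -(α / β) • π (S (S a)) := by
      rw [map_add, map_smul, map_smul] at hQ
      rw [← smul_right_inj hβ, smul_smul]
      rw [eq_neg_of_add_eq_zero_right hQ, ← neg_smul]
      congr 1
      field_simp
    simp only [map_add, map_smul, ha, ha1, h4]
    module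
  have hfix : ∀ x : K, S (τ (τ x) • a + τ (τ (τ x)) • S a + τ (τ (τ (τ x))) • S (S a) +
      x • S (S (S a)) + τ x • S (S (S (S a)))) =
      τ (τ x) • a + τ (τ (τ x)) • S a + τ (τ (τ (τ x))) • S (S a) +
      x • S (S (S a)) + τ x • S (S (S (S a))) := fun x => by
    simpa only [hτ] using h.apply_orbit_sum hτ a (τ (τ x))
  have hne : ∀ x : K, x ≠ 0 → τ (τ x) • a + τ (τ (τ x)) • S a + τ (τ (τ (τ x))) • S (S a) +
      x • S (S (S a)) + τ x • S (S (S (S a))) ≠ 0 := fun x hx h0 =>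
    hx (eq_zero_of_orbit_five hli5 h0).2.2.2.1
  refine ⟨by omega, s, -(α / β), by rwa [hK],
    by rw [hK]; exact coprime_five hs0 hs5, ?_, fun hN => ?_, ?_⟩
  · rw [Algebra.norm_ne_zero_iff]
    exact neg_ne_zero.2 (div_ne_zero hα hβ)
  -- For norm 1 the fixed vectors with parameters `x` and `t * x` have the same projection;
  -- scatteredness then puts `t` in `F₀`, although `ρ` moves it.
  · obtain ⟨x, t, hx0, ht0, ht, hxt⟩ := exists_collision_of_norm_eq_one hK hρ hN
    obtain ⟨b, hb⟩ := hΓ.scattered _ _ (hfix x) (hfix (t * x)) (hne x hx0) t (by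
      rw [← hπ, LinearMap.mem_ker, map_sub, map_smul, hval, hval, hxt]
      module)
    rw [← algebraMap_smul K b] at hb
    have hb' := congrArg π hb
    rw [map_smul, hval, hval, hxt, ← sub_eq_zero] at hb'
    have := (hli (t * x - algebraMap F₀ K b * x)
      ((t - algebraMap F₀ K b) * ((τ ^ 4) x + -(α / β) * ((τ ^ 4) ^ 4) x)) (by rw [← hb']; module)).1
    rw [← sub_mul, mul_eq_zero, sub_eq_zero] at this
    exact ht (by rw [this.resolve_right hx0, AlgEquiv.commutes])
  · have heq : projectedFixedPoints S π = {P | ∃ y : K, y ≠ 0 ∧ P = Submodule.span K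
        {y • π (S (S (S a))) + ((τ ^ 4) y + -(α / β) * ((τ ^ 4) ^ 4) y) • π (S (S a))}} := by
      ext P
      constructor
      · rintro ⟨v, hv0, hv, rfl⟩
        obtain ⟨x, rfl⟩ := h.exists_eq_orbit_sum hV hli5 hv
        refine ⟨τ (τ (τ x)), fun h0 => hv0 ?_, by rw [← hval, hτ]⟩
        have : x = 0 := by simpa using h0
        simp [this]
      · rintro ⟨y, hy0, rfl⟩
        exact ⟨_, hne y hy0, hfix y, by rw [hval]⟩
    rw [heq, hK]
    simp only [hs', hs]
    exact isProjectivelyEquivalent_graphSet hW hli _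

end Projection

/-! ### From LP type back to the position of the vertex. -/

section Recognition

variable {F₀ K V W : Type*} [Field F₀] [Field K] [Algebra F₀ K] [AddCommGroup V]
  [Module K V] [Module F₀ V] [AddCommGroup W] [Module K W] {τ : K ≃ₐ[F₀] K} {S : V ≃ₗ[F₀] V}
  {σ : Submodule K V ≃o Submodule K V} {Γ : Submodule K V} {π : V →ₗ[K] W}

/-- Since `S ^ 4 = S⁻¹`, the same plane is described by the orbit of `S⁻¹ a` with `α` and `β`
exchanged. -/
theorem IsTwist.isLPVertex_of_pow_four (h : IsTwist τ S σ) (hLP : IsLPVertex K (S ^ 4) Γ) :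
    IsLPVertex K S Γ := by
  have h5 := h.apply_five
  obtain ⟨a, α, β, ha0, hα, hβ, ha, ha1, hQ⟩ := hLP
  simp only [pow_succ, pow_zero, one_mul, LinearEquiv.mul_apply, h5] at ha1 hQ
  exact ⟨S (S (S (S a))), β, α, by simpa using ha0, hβ, hα, ha1, by rwa [h5], by
    simpa only [h5, add_comm] using hQ⟩

variable [Finite F₀]

/-- A linear parametrization of the fixed vectors is a sum over an orbit. -/
theorem IsTwist.exists_orbit_of_parametrization [IsScalarTower F₀ K V] (hK : finrank F₀ K = 5)
    (h : IsTwist τ S σ) (θ : K →ₗ[F₀] V) (hθ : ∀ x, S (θ x) = θ x) :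
    ∃ p : V, ∀ x, θ x = ∑ i : Fin 5, (τ ^ (i : ℕ)) x • (S ^ (i : ℕ)) p := by
  obtain ⟨p, hp⟩ := exists_eq_sum_pow_smul hK h.ne_one θ
  have h5 := _root_.apply_five hK τ
  -- Comparing the coefficients of `S (θ x)` and `θ x` gives `p (i + 1) = S (p i)` cyclically.
  have hzero := eq_zero_of_sum_pow_smul hK h.ne_one
    (p := ![p 0 - S (p 4), p 1 - S (p 0), p 2 - S (p 1), p 3 - S (p 2), p 4 - S (p 3)])
    fun x => by
      have := (hp x).symm.trans ((hθ x).symm.trans (congrArg S (hp x)))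
      rw [← sub_eq_zero] at this
      rw [← this]
      simp [Fin.sum_univ_five, h.map_smul, h5]
      module
  have h1 : p 1 = S (p 0) := sub_eq_zero.1 (hzero 1)
  have h2 : p 2 = S (p 1) := sub_eq_zero.1 (hzero 2)
  have h3 : p 3 = S (p 2) := sub_eq_zero.1 (hzero 3)
  have h4 : p 4 = S (p 3) := sub_eq_zero.1 (hzero 4)
  refine ⟨p 0, fun x => ?_⟩
  rw [hp]
  simp [Fin.sum_univ_five, pow_succ, h4, h3, h2, h1]

/-- In the coordinates of the equivalence, the projected fixed vectors form the graph of a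
linearized polynomial `f` with the slopes of `τ + δ τ⁻¹`. Its coefficients are the second
coordinates of an orbit `S^i p`, so those that vanish show which orbit vectors lie in `Γ`. -/
theorem IsScatteredVertex.isLPVertex_of_isProjectivelyEquivalent [IsScalarTower F₀ K V]
    (hK : finrank F₀ K = 5)
    (hT : finrank F₀ (fixedVectors S) = 5) (h : IsTwist τ S σ) (hΓ : IsScatteredVertex K S Γ)
    (hno : ∀ a, a ∈ Γ → S a ∈ Γ → S (S a) ∈ Γ → a = 0)
    (hπ : LinearMap.ker π = Γ) {δ : K} (hδ : δ ≠ 0)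
    (hL : IsProjectivelyEquivalent (projectedFixedPoints S π)
      (graphSet fun x => τ x + δ * (τ ^ 4) x)) : IsLPVertex K S Γ := by
  have : FiniteDimensional F₀ K := FiniteDimensional.of_finrank_pos (by omega)
  have : Finite K := Module.finite_of_finite F₀
  have : Fintype Kˣ := Fintype.ofFinite _
  obtain ⟨e, he⟩ := hL
  let H : V →ₗ[K] K × K := e.symm.toLinearMap ∘ₗ π
  have hker : ∀ v, H v = 0 ↔ v ∈ Γ := fun v => by simp [H, ← hπ]
  have hpt : ∀ v, v ≠ 0 → S v = v → ∃ c z : K, c ≠ 0 ∧ z ≠ 0 ∧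
      H v = c • (z, τ z + δ * (τ ^ 4) z) := fun v hv0 hv => by
    have hmem : Submodule.span K {π v} ∈ projectedFixedPoints S π := ⟨v, hv0, hv, rfl⟩
    rw [he] at hmem
    obtain ⟨_, ⟨z, hz, rfl⟩, hz'⟩ := hmem
    have hv' : π v ∈ Submodule.span K {π v} := Submodule.mem_span_singleton_self _
    rw [← hz'] at hv'
    obtain ⟨u, hu, hu'⟩ := hv'
    obtain ⟨c, rfl⟩ := Submodule.mem_span_singleton.1 hu
    have hH : H v = c • (z, τ z + δ * (τ ^ 4) z) := by
      simp only [H, LinearMap.comp_apply, ← hu']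
      simp
    refine ⟨c, z, ?_, hz, hH⟩
    rintro rfl
    rw [zero_smul, hker] at hH
    exact hv0 (hΓ.eq_zero v hH hv)
  -- The first coordinate of a projected nonzero fixed vector is `c * z ≠ 0`, so by equality of
  -- ranks it parametrizes the fixed vectors by `K`.
  let H1 : fixedVectors S →ₗ[F₀] K :=
    ((LinearMap.fst K K K ∘ₗ H).restrictScalars F₀) ∘ₗ (fixedVectors S).subtype
  have hH1 : ∀ v, H1 v = (H v).1 := fun v => rfl
  have hinj : Function.Injective H1 := by
    rw [injective_iff_map_eq_zero]
    intro v hv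
    by_contra hv0
    obtain ⟨c, z, hc, hz, hH⟩ := hpt v (fun h => hv0 (Subtype.ext h)) v.2
    rw [hH1, hH] at hv
    exact mul_ne_zero hc hz hv
  have : FiniteDimensional F₀ (fixedVectors S) := FiniteDimensional.of_finrank_pos (by omega)
  let E := LinearEquiv.ofInjectiveOfFinrankEq H1 hinj (by rw [hT, hK])
  let θ : K →ₗ[F₀] V := (fixedVectors S).subtype ∘ₗ E.symm.toLinearMap
  have hθ : ∀ x, S (θ x) = θ x := fun x => (E.symm x).2
  have hθ0 : ∀ x, x ≠ 0 → θ x ≠ 0 := fun x hx h0 => hx (by simpa [θ] using h0)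
  have hθ1 : ∀ x, (H (θ x)).1 = x := fun x => E.apply_symm_apply x
  obtain ⟨p, hp⟩ := h.exists_orbit_of_parametrization hK θ hθ
  let f : K →ₗ[F₀] K := ((LinearMap.snd K K K ∘ₗ H).restrictScalars F₀) ∘ₗ θ
  have hf : ∀ x, f x = (H (θ x)).2 := fun x => rfl
  have hcoef := coeff_eq_zero_of_slopes hK h.ne_one hδ (f := f)
    (a := fun i => (H ((S ^ (i : ℕ)) p)).2)
    (fun x => by rw [hf, hp]; simp [map_sum, Prod.snd_sum])
    (fun x y hx hy hxy => by
      have hΓ' : θ y - (y / x) • θ x ∈ Γ := by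
        rw [← hker, map_sub, map_smul]
        ext
        · simp [hθ1, hx]
        · simp only [Prod.snd_sub, Prod.smul_snd, ← hf, smul_eq_mul, Prod.snd_zero]
          field_simp at hxy ⊢
          linear_combination -hxy
      obtain ⟨b, hb⟩ := hΓ.scattered _ _ (hθ x) (hθ y) (hθ0 x hx) _ hΓ'
      refine ⟨b, ?_⟩
      have := congrArg (fun v => (H v).1) hb
      rw [← map_smul] at this
      simpa only [hθ1] using this)
    (fun x hx => by
      obtain ⟨c, z, hc, hz, hH⟩ := hpt _ (hθ0 x hx) (hθ x)
      refine ⟨z, hz, ?_⟩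
      have h1 := congrArg Prod.fst hH
      rw [hθ1] at h1
      rw [hf, hH, h1]
      exact mul_div_mul_left _ _ hc)
  -- The first coordinate of `θ x` is `x`, so among the first coordinates of the orbit of `p` only
  -- that of `p` is nonzero, and it is 1.
  have hfst := eq_zero_of_sum_pow_smul hK h.ne_one
    (p := fun i : Fin 5 => (H ((S ^ (i : ℕ)) p)).1 - if i = 0 then 1 else 0) fun x => by
      have := hθ1 x
      rw [hp] at this
      simp only [smul_sub, Finset.sum_sub_distrib]
      rw [sub_eq_zero]
      simpa [map_sum, Prod.fst_sum] using this
  have h0 : (H p).1 = 1 := by simpa [sub_eq_zero] using hfst 0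
  have h1 : (H (S p)).1 = 0 := by simpa using hfst 1
  have h2 : (H (S (S p))).1 = 0 := by simpa [pow_succ] using hfst 2
  have h3 : (H (S (S (S p)))).1 = 0 := by simpa [pow_succ] using hfst 3
  have h4 : (H (S (S (S (S p))))).1 = 0 := by simpa [pow_succ] using hfst 4
  have k2 : (H (S (S p))).2 = 0 := by simpa [pow_succ] using hcoef.2.1
  have k3 : (H (S (S (S p)))).2 = 0 := by simpa [pow_succ] using hcoef.2.2
  have hp0 : p ≠ 0 := by rintro rfl; simp at h0
  have m2 := (hker _).1 (Prod.ext h2 k2)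
  have m3 := (hker _).1 (Prod.ext h3 k3)
  -- `S² p` and `S³ p` are in `Γ`. The images of `S⁴ p` and `S⁶ p = S p` have first coordinate zero,
  -- so they are proportional, and these coefficients cancel them.
  refine ⟨S (S p), (H (S p)).2, -(H (S (S (S (S p))))).2, by simpa using hp0, fun hα => ?_,
    fun hβ => ?_, m2, m3, ?_⟩
  · exact hp0 (by simpa using hno _ ((hker _).1 (Prod.ext h1 hα)) m2 m3)
  · exact hp0 (by simpa using hno _ m2 m3 ((hker _).1 (Prod.ext h4 (neg_eq_zero.1 hβ))))
  · rw [← hker, h.apply_five, map_add, map_smul, map_smul]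
    ext
    · simp [h1, h4]
    · simp only [Prod.snd_add, Prod.smul_snd, smul_eq_mul, Prod.snd_zero]
      ring

end Recognition

/-! ### Reduction of the geometric hypotheses to semilinear algebra. -/

section Reduction

variable {F₀ K : Type*} [Field F₀] [Field K] [Algebra F₀ K]

/-- The collineation of `PGammaL` fixing a canonical subgeometry pointwise comes from a field
automorphism over the ground field, acting on coordinates. -/
theorem exists_isTwist [Finite F₀] (hK : finrank F₀ K = 5)
    {Sig : Set (Submodule K (Fin (4 + 1) → K))} (hSig : IsCanonicalSubgeometry F₀ K Sig)
    {σ : Submodule K (Fin (4 + 1) → K) ≃o Submodule K (Fin (4 + 1) → K)}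
    (hσ : σ ∈ pointwiseStabilizer Sig) (hσ1 : σ ≠ 1) :
    ∃ (τ : K ≃ₐ[F₀] K) (S : (Fin (4 + 1) → K) ≃ₗ[F₀] (Fin (4 + 1) → K)), IsTwist τ S σ ∧
      finrank F₀ (fixedVectors S) = 5 ∧
      Sig = {P | ∃ v, v ≠ 0 ∧ S v = v ∧ P = Submodule.span K {v}} := by
  obtain ⟨g, rfl⟩ := hSig
  obtain ⟨⟨t, g', hg', himg⟩, hfix⟩ := hσ
  let ι : (Fin (4 + 1) → F₀) → (Fin (4 + 1) → K) := fun a i => algebraMap F₀ K (a i)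
  have hpt : ∀ a : Fin (4 + 1) → F₀, a ≠ 0 → ∃ c : K, g' (g (ι a)) = c • g (ι a) := fun a ha => by
    have h1 := hfix _ ⟨a, ha, rfl⟩
    have h2 := himg (Submodule.span K {g (ι a)})
    rw [h1] at h2
    have h3 : g' (g (ι a)) ∈ (Submodule.span K {g (ι a)} : Set (Fin (4 + 1) → K)) := by
      rw [h2]
      exact ⟨_, Submodule.mem_span_singleton_self _, rfl⟩
    obtain ⟨c, hc⟩ := Submodule.mem_span_singleton.1 h3
    exact ⟨c, hc.symm⟩
  -- the images of the coordinate vectors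
  have hι : ∀ i, ι (Pi.single i 1) = Pi.single i 1 := fun i => by
    ext j
    by_cases h : j = i
    · subst h; simp [ι]
    · simp [ι, h]
  have hιc : ∀ i j (c : F₀), ι (Pi.single i 1 + c • Pi.single j 1) =
      Pi.single i 1 + algebraMap F₀ K c • Pi.single j 1 := fun i j c => by
    rw [← hι, ← hι]
    ext k
    simp [ι, Algebra.smul_def]
  choose lam hlam using fun i : Fin (4 + 1) => hpt (Pi.single i 1) (by simp)
  simp only [hι] at hlam
  -- The points of `e i + c • e j` are fixed too. Taking `c = 1` makes all the multipliers `lam`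
  -- equal, and general `c` then shows that `t` fixes `F₀`.
  have key : ∀ i j, i ≠ j → ∀ c : F₀, t (algebraMap F₀ K c) * lam j = algebraMap F₀ K c * lam i :=
      fun i j hij c => by
    obtain ⟨d, hd⟩ := hpt (Pi.single i 1 + c • Pi.single j 1) (fun h0 => by
      have := congrFun h0 i
      simp [hij] at this)
    rw [hιc] at hd
    have hd' : lam i • Pi.single i 1 + (t (algebraMap F₀ K c) * lam j) • Pi.single j 1 =
        d • (Pi.single i 1 + algebraMap F₀ K c • Pi.single j 1) := g.injective (by
      rw [map_smul g d, ← hd]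
      simp only [map_add, map_smul, hg', hlam, mul_smul])
    have e1 := congrFun hd' i
    have e2 := congrFun hd' j
    simp [hij, hij.symm] at e1 e2
    rw [e2, e1, Algebra.smul_def]
  have hlam0 : ∀ i, lam i ≠ 0 := fun i h0 => by
    have := hlam i
    rw [h0, zero_smul] at this
    simp at this
  have hlam_eq : ∀ i, lam i = lam 0 := fun i => by
    by_cases h : i = 0
    · rw [h]
    · simpa using key 0 i (Ne.symm h) 1
  have ht : ∀ c : F₀, t (algebraMap F₀ K c) = algebraMap F₀ K c := fun c => by
    have := key 0 1 (by decide) c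
    rw [hlam_eq 1] at this
    exact mul_right_cancel₀ (hlam0 0) this
  let τ : K ≃ₐ[F₀] K := AlgEquiv.ofRingEquiv (f := t) ht
  have hτ : ∀ x, τ x = t x := fun x => rfl
  let S : (Fin (4 + 1) → K) ≃ₗ[F₀] (Fin (4 + 1) → K) :=
    ((g.restrictScalars F₀).symm.trans (LinearEquiv.piCongrRight fun _ => τ.toLinearEquiv)).trans
      (g.restrictScalars F₀)
  have hS : ∀ v, S v = g fun i => τ (g.symm v i) := fun v => rfl
  have hg'S : ∀ v, g' v = lam 0 • S v := fun v => by
    obtain ⟨w, rfl⟩ := g.surjective v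
    have hw : ∀ w : Fin (4 + 1) → K, w = ∑ i, w i • Pi.single i (1 : K) := fun w => by
      conv_lhs => rw [← Finset.univ_sum_single w]
      exact Finset.sum_congr rfl fun i _ => by rw [← Pi.single_smul, smul_eq_mul, mul_one]
    rw [hS, LinearEquiv.symm_apply_apply, hw fun i => τ (w i)]
    conv_lhs => rw [hw w]
    simp only [map_sum, map_smul, hg', hlam, hlam_eq, Finset.smul_sum]
    exact Finset.sum_congr rfl fun i _ => smul_comm _ _ _
  have hmem : ∀ (M : Submodule K (Fin (4 + 1) → K)) v, S v ∈ σ M ↔ v ∈ M := fun M v => by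
    rw [← (σ M).smul_mem_iff (hlam0 0), ← hg'S, ← SetLike.mem_coe, himg]
    simp
  have hne : τ ≠ 1 := fun h1 => hσ1 <| by
    ext M v
    have := hmem M v
    rwa [hS, h1, show (fun i => (1 : K ≃ₐ[F₀] K) (g.symm v i)) = g.symm v from rfl,
      g.apply_symm_apply] at this
  have hfixed : ∀ v, S v = v ↔ ∃ a, v = g (ι a) := fun v => by
    rw [hS, ← g.eq_symm_apply]
    constructor
    · intro h
      choose a ha using fun i => exists_algebraMap_eq_of_fixed hK hne (congrFun h i)
      exact ⟨a, by rw [← g.symm_apply_eq]; exact (funext ha).symm⟩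
    · rintro ⟨a, rfl⟩
      ext i
      simp [ι]
  refine ⟨τ, S, ⟨hne, fun c v => ?_, fun v => ?_, hmem⟩, ?_, ?_⟩
  · rw [hS, hS, ← map_smul]
    congr 1
    ext i
    simp
  · simp only [hS, LinearEquiv.symm_apply_apply, _root_.apply_five hK]
    exact g.apply_symm_apply v
  · let ι' : (Fin (4 + 1) → F₀) →ₗ[F₀] (Fin (4 + 1) → K) :=
      (g.restrictScalars F₀).toLinearMap ∘ₗ
        LinearMap.pi fun i => (Algebra.linearMap F₀ K) ∘ₗ LinearMap.proj i
    have hι' : ∀ a, ι' a = g (ι a) := fun a => rfl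
    have hinj : Function.Injective ι' := fun a b hab => by
      have := g.injective hab
      ext i
      exact (algebraMap F₀ K).injective (congrFun this i)
    have hrange : fixedVectors S = LinearMap.range ι' := by
      ext v
      rw [mem_fixedVectors, hfixed, LinearMap.mem_range]
      simp only [hι', eq_comm]
    rw [hrange, LinearMap.finrank_range_of_inj hinj]
    simp
  · ext P
    constructor
    · rintro ⟨a, ha, rfl⟩
      refine ⟨_, fun h0 => ha ?_, (hfixed _).2 ⟨a, rfl⟩, rfl⟩
      have : ι a = 0 := by simpa using h0
      ext i
      simpa [ι] using congrFun this i
    · rintro ⟨v, hv0, hv, rfl⟩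
      obtain ⟨a, rfl⟩ := (hfixed v).1 hv
      refine ⟨a, fun h0 => hv0 ?_, rfl⟩
      rw [h0, show ι 0 = 0 from funext fun i => by simp [ι], map_zero]

/-- The graph of Frobenius is a scattered subspace of rank 5: a ratio `y / x` common to both
coordinates is fixed by Frobenius, hence lies in `F₀`. -/
theorem finrank_le_of_isMaximumScattered [Finite F₀] {W : Type*} [AddCommGroup W] [Module K W]
    [Module F₀ W] [IsScalarTower F₀ K W] (hK : finrank F₀ K = 5) (hW : finrank K W = 2)
    {U : Submodule F₀ W} (hU : IsMaximumScattered F₀ K U) : 5 ≤ finrank F₀ U := by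
  obtain ⟨τ, hτ, -⟩ := exists_frobenius (F₀ := F₀) hK
  have : FiniteDimensional K W := FiniteDimensional.of_finrank_pos (by omega)
  let e : (K × K) ≃ₗ[K] W := LinearEquiv.ofFinrankEq _ _ (by simp [hW])
  let j : K →ₗ[F₀] W := (e.restrictScalars F₀).toLinearMap ∘ₗ
    (LinearMap.id.prod τ.toLinearMap)
  have hj : ∀ x, j x = e (x, τ x) := fun x => rfl
  have hinj : Function.Injective j := fun x y hxy => congrArg Prod.fst (e.injective hxy)
  rw [← hK, ← LinearMap.finrank_range_of_inj hinj]
  refine hU.2 _ fun v => ?_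
  by_cases h0 : ∀ w ∈ (Submodule.span K {v}).restrictScalars F₀ ⊓ LinearMap.range j, w = 0
  · rw [(Submodule.eq_bot_iff _).2 h0, finrank_bot]
    omega
  · push Not at h0
    obtain ⟨w, hw, hw0⟩ := h0
    refine finrank_le_one ⟨w, hw⟩ fun z => ?_
    obtain ⟨z, hz, hz'⟩ := z
    obtain ⟨hwv, x, rfl⟩ := hw
    obtain ⟨y, rfl⟩ := hz'
    have hx0 : x ≠ 0 := by rintro rfl; simp at hw0
    obtain ⟨c, hc⟩ := Submodule.mem_span_singleton.1 hwv
    obtain ⟨d, hd⟩ := Submodule.mem_span_singleton.1 hz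
    have hc0 : c ≠ 0 := by rintro rfl; exact hw0 (by rw [← hc, zero_smul])
    have hyx : e (y, τ y) = e ((d / c) • (x, τ x)) := by
      rw [map_smul, ← hj, ← hj, ← hd, ← hc, smul_smul, div_mul_cancel₀ _ hc0]
    have h1 := e.injective hyx
    have hy : y = d / c * x := congrArg Prod.fst h1
    have hτy : τ y = d / c * τ x := congrArg Prod.snd h1
    rw [hy, map_mul] at hτy
    obtain ⟨b, hb⟩ := exists_algebraMap_eq_of_fixed hK hτ
      (mul_right_cancel₀ ((map_ne_zero τ).2 hx0) hτy)
    refine ⟨b, Subtype.ext ?_⟩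
    change b • j x = j y
    rw [← map_smul, hy, ← hb, Algebra.smul_def]

/-- The points of a subgeometry with a maximum scattered projection have distinct images. -/
theorem scattered_of_isMaximumScatteredLinearSet [Finite F₀] {V W : Type*} [AddCommGroup V]
    [Module K V] [Module F₀ V] [IsScalarTower F₀ K V] [AddCommGroup W] [Module K W]
    [Module F₀ W] [IsScalarTower F₀ K W] (hK : finrank F₀ K = 5) (hW : finrank K W = 2)
    {S : V ≃ₗ[F₀] V} (hT : finrank F₀ (fixedVectors S) = 5) {π : V →ₗ[K] W}
    (h0 : ∀ v, S v = v → π v = 0 → v = 0)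
    (hL : IsMaximumScatteredLinearSet F₀ K (projectedFixedPoints S π)) (x y : V) (hx : S x = x)
    (hy : S y = y) (hx0 : x ≠ 0) (c : K) (hc : π y = c • π x) : ∃ b : F₀, y = b • x := by
  obtain ⟨U, hU, hLU⟩ := hL
  have h5 := finrank_le_of_isMaximumScattered hK hW hU
  have : FiniteDimensional F₀ K := FiniteDimensional.of_finrank_pos (by omega)
  have : FiniteDimensional K W := FiniteDimensional.of_finrank_pos (by omega)
  have : FiniteDimensional F₀ W := FiniteDimensional.trans F₀ K W
  have : Finite W := Module.finite_of_finite F₀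
  have : FiniteDimensional F₀ (fixedVectors S) := FiniteDimensional.of_finrank_pos (by omega)
  have : Finite (fixedVectors S) := Module.finite_of_finite F₀
  let L := projectedFixedPoints S π
  have hspan : ∀ (b : F₀) (w : W), b ≠ 0 → Submodule.span K {b • w} = Submodule.span K {w} :=
    fun b w hb => by
      rw [← algebraMap_smul K b]
      exact Submodule.span_singleton_smul_eq (by simpa using hb) w
  have hπ : ∀ (b : F₀) v, π (b • v) = b • π v := fun b v => by
    rw [← algebraMap_smul K b, map_smul, algebraMap_smul]
  let β : Projectivization F₀ (fixedVectors S) → L :=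
    Projectivization.lift (fun v => ⟨Submodule.span K {π v.1.1}, v.1.1,
      fun h => v.2 (Subtype.ext h), v.1.2, rfl⟩) fun v w c hvw => by
      have hc : c ≠ 0 := by rintro rfl; exact v.2 (by rw [hvw, zero_smul])
      simp only [hvw, Submodule.coe_smul, hπ, hspan c _ hc]
  have hβ : ∀ v hv, β (Projectivization.mk F₀ v hv) = Submodule.span K {π (v : V)} :=
    fun v hv => rfl
  have hβsurj : Function.Surjective β := by
    rintro ⟨P, v, hv0, hv, rfl⟩
    exact ⟨Projectivization.mk F₀ ⟨v, hv⟩ fun h => hv0 (congrArg Subtype.val h), rfl⟩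
  -- `U` need not be the projection of the fixed vectors, so the two are compared by counting. As
  -- `U` is scattered of rank at least 5, the linear set has at least as many points as the
  -- subgeometry, and the surjection `β` must be injective.
  obtain ⟨j, hj⟩ := finrank_le_iff_exists_linearMap.1 (hT.trans_le h5)
  let γ : Projectivization F₀ U → L :=
    Projectivization.lift (fun v => ⟨Submodule.span K {(v.1 : W)}, by
      change _ ∈ projectedFixedPoints S π
      rw [hLU]
      exact ⟨v.1.1, v.1.2, fun h => v.2 (Subtype.ext h), rfl⟩⟩) fun v w c hvw => by
      have hc : c ≠ 0 := by rintro rfl; exact v.2 (by rw [hvw, zero_smul])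
      simp only [hvw, Submodule.coe_smul, hspan c _ hc]
  have hγinj : Function.Injective γ := by
    intro P Q
    induction P with | h u hu => ?_
    induction Q with | h w hw => ?_
    intro hPQ
    have hPQ' : Submodule.span K {(u : W)} = Submodule.span K {(w : W)} := congrArg Subtype.val hPQ
    obtain ⟨z, hz⟩ := finrank_le_one_iff.1 (hU.1 (u : W))
    obtain ⟨a, ha⟩ := hz ⟨u, Submodule.mem_span_singleton_self (u : W), u.2⟩
    obtain ⟨b, hb⟩ := hz ⟨w, by
      change (w : W) ∈ Submodule.span K {(u : W)}
      rw [hPQ']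
      exact Submodule.mem_span_singleton_self _, w.2⟩
    have ha' : a • (z : W) = u := congrArg Subtype.val ha
    have hb' : b • (z : W) = w := congrArg Subtype.val hb
    have hb0 : b ≠ 0 := by rintro rfl; exact hw (Subtype.ext (by rw [← hb', zero_smul]; rfl))
    rw [Projectivization.mk_eq_mk_iff']
    exact ⟨a / b, Subtype.ext (by
      rw [Submodule.coe_smul, ← ha', ← hb', smul_smul, div_mul_cancel₀ _ hb0])⟩
  have hcard : Nat.card (Projectivization F₀ (fixedVectors S)) ≤ Nat.card L := by
    have : Finite L := Finite.of_surjective β hβsurj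
    exact Nat.card_le_card_of_injective _ (hγinj.comp (Projectivization.map_injective j hj))
  have hβinj := (hβsurj.bijective_of_nat_card_le hcard).injective
  by_cases hy0 : y = 0
  · exact ⟨0, by rw [hy0, zero_smul]⟩
  have hc0 : c ≠ 0 := by rintro rfl; exact hy0 (h0 y hy (by rw [hc, zero_smul]))
  have hxy : Projectivization.mk F₀ (⟨y, hy⟩ : fixedVectors S)
      (fun h => hy0 (congrArg Subtype.val h)) =
      Projectivization.mk F₀ (⟨x, hx⟩ : fixedVectors S) (fun h => hx0 (congrArg Subtype.val h)) := by
    apply hβinj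
    apply Subtype.ext
    rw [hβ, hβ]
    change Submodule.span K {π y} = Submodule.span K {π x}
    rw [hc]
    exact Submodule.span_singleton_smul_eq (isUnit_iff_ne_zero.2 hc0) _
  obtain ⟨b, hb⟩ := (Projectivization.mk_eq_mk_iff' ..).1 hxy
  exact ⟨b, (congrArg Subtype.val hb).symm⟩

end Reduction

/-! ### Assembly of the theorem. -/

section Main

theorem submoduleOf_sup_span_singleton {K V : Type*} [Field K] [AddCommGroup V] [Module K V]
    {Γ Λ : Submodule K V} (h : IsCompl Λ Γ) (v : V) :
    (Γ ⊔ Submodule.span K {v}).submoduleOf Λ = Submodule.span K {Λ.projectionOnto Γ h v} := by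
  have hker : ∀ w, w ∈ Γ ↔ Λ.projectionOnto Γ h w = 0 := fun w => by
    rw [← LinearMap.mem_ker, Submodule.ker_projectionOnto]
  ext x
  have hx : Λ.projectionOnto Γ h (x : V) = x := Submodule.projectionOnto_apply_left h x
  rw [Submodule.submoduleOf, Submodule.mem_comap, Submodule.subtype_apply, Submodule.mem_sup,
    Submodule.mem_span_singleton]
  constructor
  · rintro ⟨y, hy, z, hz, hyz⟩
    obtain ⟨c, rfl⟩ := Submodule.mem_span_singleton.1 hz
    refine ⟨c, ?_⟩
    rw [← hx, ← hyz, map_add, (hker y).1 hy, zero_add, map_smul]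
  · rintro ⟨c, hc⟩
    refine ⟨x - c • v, ?_, c • v, Submodule.mem_span_singleton.2 ⟨c, rfl⟩, by abel⟩
    rw [hker, map_sub, map_smul, hx, hc, sub_self]

theorem projectFrom_eq_projectedFixedPoints {F₀ K V : Type*} [Field F₀] [Field K]
    [AddCommGroup V] [Module K V] [Module F₀ V] {S : V ≃ₗ[F₀] V} {Γ Λ : Submodule K V}
    (h : IsCompl Λ Γ) :
    projectFrom Γ Λ {P | ∃ v, v ≠ 0 ∧ S v = v ∧ P = Submodule.span K {v}} =
      projectedFixedPoints S (Λ.projectionOnto Γ h) := by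
  ext P
  constructor
  · rintro ⟨_, ⟨v, hv0, hv, rfl⟩, rfl⟩
    exact ⟨v, hv0, hv, submoduleOf_sup_span_singleton h v⟩
  · rintro ⟨v, hv0, hv, rfl⟩
    exact ⟨_, ⟨v, hv0, hv, rfl⟩, submoduleOf_sup_span_singleton h v⟩

theorem projectedFixedPoints_pow {F₀ K V W : Type*} [Field F₀] [Field K] [Algebra F₀ K]
    [AddCommGroup V] [Module K V] [Module F₀ V] [AddCommGroup W] [Module K W] {τ : K ≃ₐ[F₀] K}
    {S : V ≃ₗ[F₀] V} {σ : Submodule K V ≃o Submodule K V} (h : IsTwist τ S σ) {k : ℕ}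
    (h0 : 0 < k) (h5 : k < 5) (π : V →ₗ[K] W) :
    projectedFixedPoints (S ^ k) π = projectedFixedPoints S π := by
  simp only [projectedFixedPoints, h.pow_apply_eq_self_iff h0 h5]

theorem fixedVectors_pow {F₀ K V : Type*} [Field F₀] [Field K] [Algebra F₀ K]
    [AddCommGroup V] [Module K V] [Module F₀ V] {τ : K ≃ₐ[F₀] K}
    {S : V ≃ₗ[F₀] V} {σ : Submodule K V ≃o Submodule K V} (h : IsTwist τ S σ) {k : ℕ}
    (h0 : 0 < k) (h5 : k < 5) : fixedVectors (S ^ k) = fixedVectors S := by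
  ext v
  exact h.pow_apply_eq_self_iff h0 h5 v

/-- The projected points form a set of LP type if and only if `Γ` is in special position with
respect to the collineation or to its square. -/
theorem IsScatteredVertex.isLPType_iff {F₀ K V W : Type*} [Field F₀] [Finite F₀] [Field K]
    [Algebra F₀ K] [AddCommGroup V] [Module K V] [Module F₀ V] [FiniteDimensional K V]
    [IsScalarTower F₀ K V] [AddCommGroup W] [Module K W] {τ : K ≃ₐ[F₀] K} {S : V ≃ₗ[F₀] V}
    {σ : Submodule K V ≃o Submodule K V} {Γ : Submodule K V} {π : V →ₗ[K] W}
    (hK : finrank F₀ K = 5) (hV : finrank K V = 5) (hW : finrank K W = 2)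
    (hT : finrank F₀ (fixedVectors S) = 5) (h : IsTwist τ S σ) (hΓ : IsScatteredVertex K S Γ)
    (hno : ∀ k, 0 < k → k < 5 → ∀ a, a ∈ Γ → (S ^ k) a ∈ Γ → (S ^ k) ((S ^ k) a) ∈ Γ → a = 0)
    (hπ : LinearMap.ker π = Γ) :
    IsLPType F₀ K (projectedFixedPoints S π) ↔ IsLPVertex K S Γ ∨ IsLPVertex K (S ^ 2) Γ := by
  have : FiniteDimensional F₀ K := FiniteDimensional.of_finrank_pos (by omega)
  constructor
  · rintro ⟨-, s, δ, hs, hcop, hδ, -, hL⟩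
    rw [hK] at hs hcop
    have hs0 : 0 < s := Nat.pos_of_ne_zero fun h0 => by simp [h0] at hcop
    obtain ⟨ρ, hρ, hρ1, hρ4⟩ := exists_algEquiv_eq_pow (F₀ := F₀) hK hs0 hs
    obtain ⟨k, hk5, rfl⟩ := exists_pow_eq_of_ne_one hK h.ne_one ρ
    have hk0 : 0 < k := Nat.pos_of_ne_zero fun h0 => hρ (by rw [h0, pow_zero])
    have hLP : IsLPVertex K (S ^ k) Γ := by
      refine (hΓ.pow h hk0 hk5).isLPVertex_of_isProjectivelyEquivalent hK
        (by rw [fixedVectors_pow h hk0 hk5, hT]) (h.pow hK hk0 hk5) (hno k hk0 hk5) hπ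
        (Algebra.norm_ne_zero_iff.1 hδ) ?_
      rw [projectedFixedPoints_pow h hk0 hk5]
      simpa only [hρ1, hρ4, hK] using hL
    -- Modulo 5 the exponents 4 and 3 are the negatives of 1 and 2, and the special position is
    -- invariant under inversion.
    interval_cases k
    · exact Or.inl (by simpa using hLP)
    · exact Or.inr hLP
    · refine Or.inr ((h.pow hK two_pos (by omega)).isLPVertex_of_pow_four ?_)
      rwa [← pow_mul, show 2 * 4 = 5 + 3 from rfl, pow_add, h.pow_five, one_mul]
    · exact Or.inl (h.isLPVertex_of_pow_four hLP)
  · rintro (hLP | hLP)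
    · exact hΓ.isLPType hK hV hW h hπ hLP
    · rw [← projectedFixedPoints_pow h two_pos (by omega)]
      exact (hΓ.pow h two_pos (by omega)).isLPType hK hV hW (h.pow hK two_pos (by omega)) hπ hLP

theorem mainTheorem6 {F₀ K : Type*} [Field F₀] [Finite F₀] [Field K] [Algebra F₀ K]
    (hK : finrank F₀ K = 5)
    (Sig : Set (Submodule K (Fin (4 + 1) → K))) (hSig : IsCanonicalSubgeometry F₀ K Sig)
    (Γ Λ : Submodule K (Fin (4 + 1) → K)) (hΓ : finrank K Γ = 3)
    (hΓSig : ∀ P ∈ Sig, ¬ P ≤ Γ) (hΛ : IsCompl Γ Λ)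
    (hL : IsMaximumScatteredLinearSet F₀ K (projectFrom Γ Λ Sig))
    (hL' : ¬ IsPseudoregulusType F₀ K (projectFrom Γ Λ Sig))
    (σ : Submodule K (Fin (4 + 1) → K) ≃o Submodule K (Fin (4 + 1) → K))
    (hσ : σ ∈ pointwiseStabilizer Sig) (hσ1 : σ ≠ 1)
    (A B E F : Submodule K (Fin (4 + 1) → K))
    (hA : A = Γ ⊓ (σ ^ 4) Γ) (hB : B = Γ ⊓ (σ ^ 3) Γ)
    (hE : E = (A ⊔ B) ⊓ (σ A ⊔ (σ ^ 2) B)) (hF : F = (A ⊔ (σ ^ 2) B) ⊓ (σ A ⊔ B)) :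
    (finrank K A = 1 ∧ finrank K B = 1 ∧ finrank K E = 1 ∧ finrank K F = 1) ∧
      (IsLPType F₀ K (projectFrom Γ Λ Sig) ↔
        E ≤ (σ ^ 2) A ⊔ (σ ^ 4) A ∨ F ≤ (σ ^ 3) B ⊔ (σ ^ 4) B) := by
  obtain ⟨τ, S, h, hT, rfl⟩ := exists_isTwist hK hSig hσ hσ1
  rw [projectFrom_eq_projectedFixedPoints hΛ.symm] at *
  have hV : finrank K (Fin (4 + 1) → K) = 5 := by simp
  have hW : finrank K Λ = 2 := by
    have := Submodule.finrank_add_eq_of_isCompl hΛ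
    omega
  have hπ : LinearMap.ker (Λ.projectionOnto Γ hΛ.symm) = Γ := Submodule.ker_projectionOnto _
  have h0 : ∀ x ∈ Γ, S x = x → x = 0 := fun x hx hSx => by
    by_contra hx0
    exact hΓSig _ ⟨x, hx0, hSx, rfl⟩ ((Submodule.span_singleton_le_iff_mem _ _).2 hx)
  have hv : IsScatteredVertex K S Γ := by
    refine ⟨hΓ, h0, fun x y hx hy hx0 c hc => ?_⟩
    refine scattered_of_isMaximumScatteredLinearSet hK hW hT
      (fun v hv hv' => h0 v (by rwa [← hπ, LinearMap.mem_ker]) hv) hL x y hx hy hx0 c ?_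
    rwa [← hπ, LinearMap.mem_ker, map_sub, map_smul, sub_eq_zero] at hc
  have hno : ∀ k, 0 < k → k < 5 → ∀ a, a ∈ Γ → (S ^ k) a ∈ Γ → (S ^ k) ((S ^ k) a) ∈ Γ →
      a = 0 := fun k hk0 hk5 a ha ha1 ha2 => by
    by_contra ha0
    apply hL'
    rw [← projectedFixedPoints_pow h hk0 hk5]
    exact (hv.pow h hk0 hk5).isPseudoregulusType hK hV hW (h.pow hK hk0 hk5) hπ ha0 ha ha1 ha2
  have h5 := h.pow_five_apply
  have hno1 : ∀ a, a ∈ Γ → S a ∈ Γ → S (S a) ∈ Γ → a = 0 := by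
    simpa using hno 1 one_pos (by omega)
  have h2 := h.pow hK two_pos (by omega)
  have hv2 := hv.pow h two_pos (by omega)
  have hno2 := hno 2 two_pos (by omega)
  have hσA : σ A = Γ ⊓ σ Γ := by
    rw [hA, OrderIso.map_inf]
    simp [pow_succ, h5, inf_comm]
  have hA1 : finrank K A = 1 := by
    rw [← h.finrank_apply, hσA]
    exact hv.finrank_inf_apply hV h hno1
  have hB1 : finrank K B = 1 := by
    have hσB : (σ ^ 2) ((σ ^ 3) Γ) = Γ := by simp [pow_succ, h5]
    rw [← h2.finrank_apply, hB, OrderIso.map_inf, hσB, inf_comm]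
    exact hv2.finrank_inf_apply hV h2 hno2
  -- With `σ ^ 2` in place of `σ`, the points `B` and `σ A` take the roles of `A` and `B`, and `F`
  -- that of `E`.
  have hB' : B = Γ ⊓ ((σ ^ 2) ^ 4) Γ := by rw [hB]; simp [pow_succ, h5]
  have hA' : σ A = Γ ⊓ ((σ ^ 2) ^ 3) Γ := by rw [hσA]; simp [pow_succ, h5]
  have hσA1 : finrank K (σ A) = 1 := by rw [h.finrank_apply, hA1]
  have hF' : F = (B ⊔ σ A) ⊓ ((σ ^ 2) B ⊔ ((σ ^ 2) ^ 2) (σ A)) := by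
    rw [hF, inf_comm, sup_comm (σ A), sup_comm A]
    simp [pow_succ, h5]
  refine ⟨⟨hA1, hB1, ?_, ?_⟩, ?_⟩
  · rw [hE]
    exact hv.finrank_diagonal_point hK h hno1 hA hB hA1 hB1
  · rw [hF']
    exact hv2.finrank_diagonal_point hK h2 hno2 hB' hA' hB1 hσA1
  · rw [hv.isLPType_iff hK hV hW hT h hno hπ, hE, hF',
      hv.diagonal_point_le_iff hK h hno1 hA hB hA1 hB1,
      ← hv2.diagonal_point_le_iff hK h2 hno2 hB' hA' hB1 hσA1]
    have e1 : ((σ ^ 2) ^ 2) B ⊔ ((σ ^ 2) ^ 4) B = (σ ^ 3) B ⊔ (σ ^ 4) B := by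
      rw [sup_comm]
      simp [pow_succ, h5]
    rw [e1]

end Main
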